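/- Let $p\ge 1$, $0<\alpha_1<1$, $\alpha_2:=1-\alpha_1$, let $\mu_1\ne\mu_2$ be vectors in $\mathbb{R}^p$ and let $\Sigma\in\mathbb{R}^{p\times p}$ be symmetric positive definite. Let $x$ have the normal mixture distribution $\alpha_1\mathcal{N}_p(\mu_1,\Sigma)+\alpha_2\mathcal{N}_p(\mu_2,\Sigma)$. Put $$h:=\mu_2-\mu_1,\quad \theta:=\Sigma^{-1}h,\quad \beta:=\alpha_1\alpha_2,\quad \tau:=h'\Sigma^{-1}h .$$ Assume one of the following two conditions. (i) $h$ is an eigenvector of $\Sigma$ and, with $\phi$ the corresponding eigenvalue, the second-to-largest eigenvalue (counted with multiplicity) of $\mathrm{Cov}(x)$ satisfies $\phi_2\{\mathrm{Cov}(x)\}<\phi(1+\beta\tau)$ (if $p=1$, this inequality is void). (ii) The unit-length leading eigenvectors of $\mathrm{Cov}(x)$ are exactly $\pm\theta/\|\theta\|$. Let $x_1,x_2,\dots$ be independent copies of $x$, let $C_n:=\frac1n\sum_{i=1}^n(x_i-\bar x_n)(x_i-\bar x_n)'$ with $\bar x_n:=\frac1n\sum_{i=1}^n x_i$, and let $(u_n)$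 be any sequence of random vectors such that, for each $n\ge1$, almost surely $u_n$ is a unit-length eigenvector of $C_n$ for the largest eigenvalue of $C_n$. Then there is a sequence of random signs $s_n\in\{-1,1\}$ such that, as $n\to\infty$: 1) $s_nu_n\to\theta/\|\theta\|$ almost surely. 2) $\theta/\|\theta\|$ is an eigenvector of $\mathrm{Cov}(x)$ and, with $\lambda_1$ the corresponding eigenvalue, $\sqrt n\,(s_nu_n-\theta/\|\theta\|)$ converges in distribution to $\mathcal{N}_p(0,\Psi_{\mathrm{PCA}})$, where $$\Psi_{\mathrm{PCA}}:=\frac{1+\beta\tau}{\|\theta\|^2}\,M^\dagger\left[\tau\left(\Sigma-\tau^{-1}hh'\right)+(1+\beta\tau)\{\kappa(\theta)-1\}\,hh'\right]M^\dagger$$ is positive semidefinite. Here $M:=\Sigma+\beta hh'-\lambda_1 I_p$, $M^\dagger$ is the Moore-Penrose pseudoinverse of $M$, and $$\kappa(\theta):=\frac{\mathrm{E}\left[\{\theta'(x-\mathrm{E}x)\}^4\right]}{\left(\mathrm{E}\left[\{\theta'(x-\mathrm{E}x)\}^2\right]\right)^2}$$ is the kurtosis of $x$ in the direction $\theta$.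 -/

import Mathlib

open MeasureTheory ProbabilityTheory Filter Topology
open scoped Matrix

namespace MixturePCA

section PseudoInverse

variable {m n : ℕ}

/-- The four Penrose conditions: `N` is a Moore-Penrose pseudoinverse of the real matrix `M`. -/
structure IsMoorePenrose (M : Matrix (Fin m) (Fin n) ℝ) (N : Matrix (Fin n) (Fin m) ℝ) :
    Prop where
  mul_mul_left : M * N * M = M
  mul_mul_right : N * M * N = N
  symm_left : (M * N)ᵀ = M * N
  symm_right : (N * M)ᵀ = N * M

/-- The Moore-Penrose pseudoinverse is unique. -/
theorem IsMoorePenrose.unique {M : Matrix (Fin m) (Fin n) ℝ} {N K : Matrix (Fin n) (Fin m) ℝ}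
    (hN : IsMoorePenrose M N) (hK : IsMoorePenrose M K) : N = K := by
  have h1 : M * N = M * K := by
    calc M * N = (M * K * M) * N := by rw [hK.mul_mul_left]
      _ = (M * K) * (M * N) := by simp only [Matrix.mul_assoc]
      _ = (M * K)ᵀ * (M * N)ᵀ := by rw [hK.symm_left, hN.symm_left]
      _ = (M * N * M * K)ᵀ := by rw [← Matrix.transpose_mul]; simp only [Matrix.mul_assoc]
      _ = M * K := by rw [hN.mul_mul_left, hK.symm_left]
  have h2 : N * M = K * M := by
    calc N * M = N * (M * K * M) := by rw [hK.mul_mul_left]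
      _ = (N * M) * (K * M) := by simp only [Matrix.mul_assoc]
      _ = (N * M)ᵀ * (K * M)ᵀ := by rw [hK.symm_right, hN.symm_right]
      _ = (K * (M * N * M))ᵀ := by rw [← Matrix.transpose_mul]; simp only [Matrix.mul_assoc]
      _ = K * M := by rw [hN.mul_mul_left, hK.symm_right]
  calc N = N * M * N := hN.mul_mul_right.symm
    _ = K * (M * N) := by rw [h2, Matrix.mul_assoc]
    _ = K * M * K := by rw [h1, Matrix.mul_assoc]
    _ = K := hK.mul_mul_right

/-- A symmetric real matrix has a symmetric Moore-Penrose pseudoinverse. -/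
theorem exists_isMoorePenrose_of_isHermitian {A : Matrix (Fin n) (Fin n) ℝ}
    (hA : A.IsHermitian) : ∃ G, IsMoorePenrose A G ∧ Gᵀ = G := by
  obtain ⟨U, d, hU, rfl⟩ : ∃ (U : Matrix (Fin n) (Fin n) ℝ) (d : Fin n → ℝ),
      Uᵀ * U = 1 ∧ A = U * Matrix.diagonal d * Uᵀ := by
    refine ⟨hA.eigenvectorUnitary, hA.eigenvalues, ?_, ?_⟩
    · have := Unitary.coe_star_mul_self hA.eigenvectorUnitary
      simpa [Matrix.star_eq_conjTranspose, Matrix.conjTranspose_eq_transpose_of_trivial] using this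
    · have := hA.spectral_theorem
      simpa [Matrix.star_eq_conjTranspose, Matrix.conjTranspose_eq_transpose_of_trivial,
        Unitary.conjStarAlgAut_apply, Function.comp_def] using this
  have key : ∀ a b : Fin n → ℝ, (U * Matrix.diagonal a * Uᵀ) * (U * Matrix.diagonal b * Uᵀ)
      = U * Matrix.diagonal (fun i => a i * b i) * Uᵀ := by
    intro a b
    calc _ = U * Matrix.diagonal a * (Uᵀ * U) * Matrix.diagonal b * Uᵀ := by
          simp only [Matrix.mul_assoc]
      _ = _ := by rw [hU, Matrix.mul_one, Matrix.mul_assoc U, Matrix.diagonal_mul_diagonal]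
  have ht : ∀ a : Fin n → ℝ, (U * Matrix.diagonal a * Uᵀ)ᵀ = U * Matrix.diagonal a * Uᵀ := by
    intro a
    simp [Matrix.transpose_mul, Matrix.mul_assoc]
  refine ⟨U * Matrix.diagonal (fun i => (d i)⁻¹) * Uᵀ, ⟨?_, ?_, ?_, ?_⟩, ht _⟩
  · rw [key, key]
    congr 3
    funext i
    exact mul_inv_mul_cancel (d i)
  · rw [key, key]
    congr 3
    funext i
    by_cases h : d i = 0 <;> simp [h]
  · rw [key, ht]
  · rw [key, ht]

/-- Every real matrix has a Moore-Penrose pseudoinverse. -/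
theorem exists_isMoorePenrose (M : Matrix (Fin m) (Fin n) ℝ) : ∃ N, IsMoorePenrose M N := by
  have hA : (Mᵀ * M).IsHermitian := by
    simpa [Matrix.conjTranspose_eq_transpose_of_trivial] using
      Matrix.isHermitian_conjTranspose_mul_self M
  obtain ⟨G, hG, hGt⟩ := exists_isMoorePenrose_of_isHermitian hA
  have hM : M * G * Mᵀ * M = M := by
    have h0 : Mᵀ * M * (G * Mᵀ * M - 1) = 0 := by
      rw [Matrix.mul_sub, Matrix.mul_one, sub_eq_zero]
      calc _ = Mᵀ * M * G * (Mᵀ * M) := by simp only [Matrix.mul_assoc]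
        _ = _ := hG.mul_mul_left
    have h1 : M * (G * Mᵀ * M - 1) = 0 := by
      rw [← Matrix.conjTranspose_mul_self_mul_eq_zero]
      simpa [Matrix.conjTranspose_eq_transpose_of_trivial] using h0
    rw [Matrix.mul_sub, Matrix.mul_one, sub_eq_zero] at h1
    simpa only [Matrix.mul_assoc] using h1
  refine ⟨G * Mᵀ, ⟨?_, ?_, ?_, ?_⟩⟩
  · simpa only [Matrix.mul_assoc] using hM
  · calc G * Mᵀ * M * (G * Mᵀ) = G * (Mᵀ * M) * G * Mᵀ := by simp only [Matrix.mul_assoc]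
      _ = G * Mᵀ := by rw [hG.mul_mul_right]
  · simp [Matrix.transpose_mul, hGt, Matrix.mul_assoc]
  · rw [Matrix.mul_assoc]
    exact hG.symm_right

/-- The Moore-Penrose pseudoinverse of a real matrix. -/
noncomputable def pinv (M : Matrix (Fin m) (Fin n) ℝ) : Matrix (Fin n) (Fin m) ℝ :=
  (exists_isMoorePenrose M).choose

theorem isMoorePenrose_pinv (M : Matrix (Fin m) (Fin n) ℝ) : IsMoorePenrose M (pinv M) :=
  (exists_isMoorePenrose M).choose_spec

end PseudoInverse

section Moments

variable {p : ℕ}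

/-- The covariance matrix of a probability distribution on `ℝᵖ`. -/
noncomputable def covMatrix (ν : Measure (EuclideanSpace ℝ (Fin p))) :
    Matrix (Fin p) (Fin p) ℝ :=
  Matrix.of fun i j => cov[fun x => x i, fun x => x j; ν]

theorem covMatrix_isHermitian (ν : Measure (EuclideanSpace ℝ (Fin p))) :
    (covMatrix ν).IsHermitian := by
  ext i j
  simp [covMatrix, covariance_comm]

/-- The kurtosis of a distribution on `ℝᵖ` in the (nonzero) direction `u`. -/
noncomputable def kurtosis (ν : Measure (EuclideanSpace ℝ (Fin p)))
    (u : EuclideanSpace ℝ (Fin p)) : ℝ :=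
  (∫ x, (inner ℝ u (x - ∫ z, z ∂ν)) ^ 4 ∂ν) / (∫ x, (inner ℝ u (x - ∫ z, z ∂ν)) ^ 2 ∂ν) ^ 2

/-- The mean of the first `n` terms of a sequence of data points. -/
noncomputable def sampleMean (x : ℕ → EuclideanSpace ℝ (Fin p)) (n : ℕ) :
    EuclideanSpace ℝ (Fin p) :=
  (n : ℝ)⁻¹ • ∑ i ∈ Finset.range n, x i

/-- The sample covariance matrix (with factor `1/n`) of the first `n` terms of a sequence
of data points. -/
noncomputable def sampleCov (x : ℕ → EuclideanSpace ℝ (Fin p)) (n : ℕ) :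
    Matrix (Fin p) (Fin p) ℝ :=
  (n : ℝ)⁻¹ • ∑ i ∈ Finset.range n,
    Matrix.vecMulVec (x i - sampleMean x n).ofLp (x i - sampleMean x n).ofLp

/-- `v` is a unit-length eigenvector of `A` for the largest eigenvalue of `A`. -/
def IsLeadingUnitEigenvector (A : Matrix (Fin p) (Fin p) ℝ) (v : EuclideanSpace ℝ (Fin p)) :
    Prop :=
  ‖v‖ = 1 ∧ ∃ lam : ℝ, Module.End.HasEigenvector (Matrix.toEuclideanLin A) lam v ∧
    ∀ c : ℝ, Module.End.HasEigenvalue (Matrix.toEuclideanLin A) c → c ≤ lam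

end Moments

section Model

variable {p : ℕ}

/-- The normal mixture `α₁ N(μ₁, S) + (1 - α₁) N(μ₂, S)`. -/
noncomputable def mixture (α₁ : ℝ) (μ₁ μ₂ : EuclideanSpace ℝ (Fin p))
    (S : Matrix (Fin p) (Fin p) ℝ) : Measure (EuclideanSpace ℝ (Fin p)) :=
  ENNReal.ofReal α₁ • multivariateGaussian μ₁ S
    + ENNReal.ofReal (1 - α₁) • multivariateGaussian μ₂ S

/-- `θ = S⁻¹ (μ₂ - μ₁)`. -/
noncomputable def theta (μ₁ μ₂ : EuclideanSpace ℝ (Fin p)) (S : Matrix (Fin p) (Fin p) ℝ) :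
    EuclideanSpace ℝ (Fin p) :=
  Matrix.toEuclideanLin S⁻¹ (μ₂ - μ₁)

/-- The standardized linear discriminant direction `θ / ‖θ‖`. -/
noncomputable def thetaDir (μ₁ μ₂ : EuclideanSpace ℝ (Fin p)) (S : Matrix (Fin p) (Fin p) ℝ) :
    EuclideanSpace ℝ (Fin p) :=
  ‖theta μ₁ μ₂ S‖⁻¹ • theta μ₁ μ₂ S

/-- `β = α₁ α₂` with `α₂ = 1 - α₁`. -/
def beta (α₁ : ℝ) : ℝ := α₁ * (1 - α₁)

/-- The squared Mahalanobis distance `τ = (μ₂ - μ₁)' S⁻¹ (μ₂ - μ₁)`. -/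
noncomputable def tau (μ₁ μ₂ : EuclideanSpace ℝ (Fin p)) (S : Matrix (Fin p) (Fin p) ℝ) : ℝ :=
  (μ₂ - μ₁).ofLp ⬝ᵥ (S⁻¹ *ᵥ (μ₂ - μ₁).ofLp)

/-- The vector `h = μ₂ - μ₁` is an eigenvector of `S`, and, for its eigenvalue `φ`, the
second-to-largest eigenvalue of the covariance matrix of the mixture is less than `φ (1 + β τ)`.
Here `eigenvalues₀` lists the eigenvalues, with multiplicity, in decreasing order from index `0`;
for `p = 1` there is no second eigenvalue and so no inequality. -/
def EigenvalueCondition (α₁ : ℝ) (μ₁ μ₂ : EuclideanSpace ℝ (Fin p))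
    (S : Matrix (Fin p) (Fin p) ℝ) : Prop :=
  ∃ φ : ℝ, Module.End.HasEigenvector (Matrix.toEuclideanLin S) φ (μ₂ - μ₁) ∧
    ∀ hp : 1 < Fintype.card (Fin p),
      (covMatrix_isHermitian (mixture α₁ μ₁ μ₂ S)).eigenvalues₀ ⟨1, hp⟩
        < φ * (1 + beta α₁ * tau μ₁ μ₂ S)

/-- The unit-length leading eigenvectors of the covariance matrix of the mixture are exactly
`± θ / ‖θ‖`. -/
def UniqueLeadingCondition (α₁ : ℝ) (μ₁ μ₂ : EuclideanSpace ℝ (Fin p))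
    (S : Matrix (Fin p) (Fin p) ℝ) : Prop :=
  ∀ v : EuclideanSpace ℝ (Fin p),
    IsLeadingUnitEigenvector (covMatrix (mixture α₁ μ₁ μ₂ S)) v ↔
      v = thetaDir μ₁ μ₂ S ∨ v = -thetaDir μ₁ μ₂ S

/-- The matrix `h h'` with `h = μ₂ - μ₁`. -/
def hhT (μ₁ μ₂ : EuclideanSpace ℝ (Fin p)) : Matrix (Fin p) (Fin p) ℝ :=
  Matrix.vecMulVec (μ₂ - μ₁).ofLp (μ₂ - μ₁).ofLp

/-- The matrix `M = S + β h h' - lam I`. -/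
noncomputable def matM (α₁ : ℝ) (μ₁ μ₂ : EuclideanSpace ℝ (Fin p))
    (S : Matrix (Fin p) (Fin p) ℝ) (lam : ℝ) : Matrix (Fin p) (Fin p) ℝ :=
  S + beta α₁ • hhT μ₁ μ₂ - lam • (1 : Matrix (Fin p) (Fin p) ℝ)

/-- The limiting covariance matrix `Ψ_PCA`, as a function of the parameters and of the eigenvalue
`lam` that belongs to the direction `θ / ‖θ‖`. -/
noncomputable def psiPCA (α₁ : ℝ) (μ₁ μ₂ : EuclideanSpace ℝ (Fin p))
    (S : Matrix (Fin p) (Fin p) ℝ) (lam : ℝ) : Matrix (Fin p) (Fin p) ℝ :=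
  ((1 + beta α₁ * tau μ₁ μ₂ S) / ‖theta μ₁ μ₂ S‖ ^ 2) •
    (pinv (matM α₁ μ₁ μ₂ S lam) *
      (tau μ₁ μ₂ S • (S - (tau μ₁ μ₂ S)⁻¹ • hhT μ₁ μ₂)
        + ((1 + beta α₁ * tau μ₁ μ₂ S)
            * (kurtosis (mixture α₁ μ₁ μ₂ S) (theta μ₁ μ₂ S) - 1)) • hhT μ₁ μ₂) *
      pinv (matM α₁ μ₁ μ₂ S lam))

end Model

end MixturePCA

open MixturePCA

/-! Write `t = θ/‖θ‖`, `m = E x` and `M = Cov(x) - λ₁ I`. Since `Cov(x) = Σ + β hh'`, the identity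
`Cov(x) θ = (1 + βτ) h` always holds. Either condition then gives `h = φ θ` with `φ > 0`, and makes
`λ₁ = φ (1 + βτ)` a simple largest eigenvalue of `Cov(x)` with eigenspace `ℝ t`
(`exists_leading_eigenvalue`).

The spectral gap makes the leading eigenvector differentiable in the matrix: a unit leading
eigenvector `v` of `C` with `⟨t, v⟩ ≥ 0` satisfies `v - t = -M† C t + O(‖C - Cov(x)‖²)`
(`norm_sub_add_le`). For the sample covariance matrix, up to a rank-one term of size `‖x̄ - m‖²`,
the vector `C t` is an average of the independent vectors `⟨t, xᵢ - m⟩ (xᵢ - m)`. The law of large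
numbers gives consistency and the central limit theorem gives the normal limit
(`tendstoInDistribution_scatter`). The remainder is bounded by a variable of mean `O(1/n)`, so it
stays negligible after multiplication by `√n`.

For the limiting covariance, let `b = M† a`. It is orthogonal to `t`, hence to `h`. In each Gaussian
component `b'(x - m)` is therefore centred with variance `b'Σb`, and it is independent of `t'(x -
m)` because `b'Σt = φ b't = 0`. So `b'(x - m) t'(x - m)` has variance `λ₁ b'Σb`, and the limit has
covariance `λ₁ M† Σ M†`. This is `Ψ_PCA`, because `M† h = 0` deletes every `hh'` term, the kurtosis
included (`psiPCA_eq`). -/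

namespace MixturePCA

/-! ### Perturbation of a simple leading eigenvector -/

section Perturbation

open scoped RealInnerProductSpace

variable {E : Type*} [NormedAddCommGroup E] [InnerProductSpace ℝ E]

theorem exists_orthonormal_eigenbasis [FiniteDimensional ℝ E] {T : E →ₗ[ℝ] E}
    (hT : T.IsSymmetric) :
    ∃ (b : OrthonormalBasis (Fin (Module.finrank ℝ E)) ℝ E) (d : Fin (Module.finrank ℝ E) → ℝ),
      ∀ i, T (b i) = d i • b i ∧ Module.End.HasEigenvalue T (d i) :=
  ⟨hT.eigenvectorBasis rfl, hT.eigenvalues rfl, fun i =>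
    ⟨hT.apply_eigenvectorBasis rfl i, hT.hasEigenvalue_eigenvalues rfl i⟩⟩

/-- A symmetric operator whose eigenvalues are at most `c` has quadratic form at most `c‖x‖²`. -/
theorem inner_apply_le_of_eigenvalue_le [FiniteDimensional ℝ E] {T : E →ₗ[ℝ] E}
    (hT : T.IsSymmetric) {c : ℝ} (hc : ∀ a : ℝ, Module.End.HasEigenvalue T a → a ≤ c) (x : E) :
    ⟪T x, x⟫ ≤ c * ‖x‖ ^ 2 := by
  obtain ⟨b, d, hbd⟩ := exists_orthonormal_eigenbasis hT
  rw [← b.sum_inner_mul_inner, ← b.sum_sq_inner_right x, Finset.mul_sum]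
  refine Finset.sum_le_sum fun i _ => ?_
  rw [hT x (b i), (hbd i).1, inner_smul_right, real_inner_comm]
  nlinarith [sq_nonneg ⟪b i, x⟫, hc _ (hbd i).2]

/-- Spectral gap below a simple largest eigenvalue. -/
theorem exists_spectral_gap [FiniteDimensional ℝ E] {T : E →ₗ[ℝ] E} (hT : T.IsSymmetric)
    {t : E} {lam : ℝ}
    (hmax : ∀ a : ℝ, Module.End.HasEigenvalue T a → a ≤ lam)
    (hsimple : ∀ v, T v = lam • v → ∃ r : ℝ, v = r • t) :
    ∃ g > 0, ∀ v, ⟪t, v⟫ = 0 → ⟪T v, v⟫ ≤ (lam - g) * ‖v‖ ^ 2 := by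
  obtain ⟨b, d, hbd⟩ := exists_orthonormal_eigenbasis hT
  -- There are finitely many eigenvalues, so one small `g` separates `lam` from all those strictly
  -- below it.
  obtain ⟨g, hg, hgd⟩ : ∃ g > 0, ∀ i, d i < lam → d i ≤ lam - g := by
    have h : ∀ i, ∀ᶠ g in 𝓝[>] (0 : ℝ), d i < lam → d i ≤ lam - g := by
      intro i
      by_cases hi : d i < lam
      · filter_upwards [Ioo_mem_nhdsGT (sub_pos.2 hi)] with g hg _
        linarith [hg.2]
      · exact .of_forall fun g h => absurd h hi
    obtain ⟨g, h1, h2⟩ := ((eventually_all.2 h).and self_mem_nhdsWithin).exists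
    exact ⟨g, h2, h1⟩
  refine ⟨g, hg, fun v hv => ?_⟩
  rw [← b.sum_inner_mul_inner, ← b.sum_sq_inner_right v, Finset.mul_sum]
  refine Finset.sum_le_sum fun i _ => ?_
  rw [hT v (b i), (hbd i).1, inner_smul_right, real_inner_comm]
  rcases (hmax _ (hbd i).2).lt_or_eq with h | h
  · nlinarith [sq_nonneg ⟪b i, v⟫, hgd i h]
  -- Basis vectors with eigenvalue `lam` are multiples of `t`, so `v` has no component along them.
  · obtain ⟨r, hr⟩ := hsimple (b i) (by rw [(hbd i).1, h])
    rw [hr, inner_smul_left, hv]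
    simp

variable {G C N : E →ₗ[ℝ] E} {t v : E} {lam g δ ℓ K : ℝ}

theorem norm_sub_smul_sq (ht : ‖t‖ = 1) (hv : ‖v‖ = 1) :
    ‖v - ⟪t, v⟫ • t‖ ^ 2 = 1 - ⟪t, v⟫ ^ 2 := by
  rw [norm_sub_sq_real, hv, norm_smul, ht, inner_smul_right, real_inner_comm, mul_pow,
    Real.norm_eq_abs, sq_abs]
  ring

/-- The component of a leading eigenvector of `C` orthogonal to the leading eigenvector of `G`
is controlled by the size of `C - G`. -/
theorem norm_orthogonal_component_le (hG : G.IsSymmetric) (ht : ‖t‖ = 1) (hGt : G t = lam • t)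
    (hg : 0 < g) (hgap : ∀ v, ⟪t, v⟫ = 0 → ⟪G v, v⟫ ≤ (lam - g) * ‖v‖ ^ 2)
    (hδ : ∀ x, ‖C x - G x‖ ≤ δ * ‖x‖) (hv : ‖v‖ = 1)
    (hCv : C v = ℓ • v) (hmax : ∀ x, ⟪C x, x⟫ ≤ ℓ * ‖x‖ ^ 2) :
    ‖v - ⟪t, v⟫ • t‖ ≤ 2 * δ / g ∧ |ℓ - lam| ≤ δ := by
  set w := v - ⟪t, v⟫ • t with hw
  have htw : ⟪t, w⟫ = 0 := by
    rw [hw, inner_sub_right, inner_smul_right, real_inner_self_eq_norm_sq, ht]; ring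
  have hvw : ⟪v, w⟫ = ‖w‖ ^ 2 := by
    have : v = w + ⟪t, v⟫ • t := by rw [hw]; abel
    rw [this, inner_add_left, inner_smul_left, htw, real_inner_self_eq_norm_sq]; simp
  have hvdec : v = w + ⟪t, v⟫ • t := by rw [hw]; abel
  have hGvw : ⟪G v, w⟫ = ⟪G w, w⟫ := by
    conv_lhs => rw [hvdec]
    rw [map_add, map_smul, hGt, inner_add_left, inner_smul_left, inner_smul_left, htw]; simp
  have hsq := norm_sub_smul_sq ht hv
  have hw1 : ‖w‖ ≤ 1 := by
    rw [← hw] at hsq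
    nlinarith [sq_nonneg ⟪t, v⟫, norm_nonneg w]
  have hcs : ∀ x y, |⟪C x - G x, y⟫| ≤ δ * ‖x‖ * ‖y‖ := fun x y =>
    (abs_real_inner_le_norm _ _).trans (by gcongr; exact hδ x)
  -- Rayleigh quotients: `t` tests `C` for the lower bound, and `v` tests `G` for the upper one.
  have hlow : lam - δ ≤ ℓ := by
    have h1 := hmax t
    have h2 := abs_le.1 (hcs t t)
    rw [inner_sub_left, hGt, inner_smul_left, real_inner_self_eq_norm_sq, ht] at h2
    rw [ht] at h1
    simp only [RCLike.conj_to_real] at h2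
    linarith [h2.1]
  have hGvv : ⟪G v, v⟫ ≤ lam := by
    have h1 : ⟪G v, v⟫ = ⟪G w, w⟫ + lam * ⟪t, v⟫ ^ 2 := by
      have : ⟪G v, v⟫ = ⟪G v, w⟫ + ⟪t, v⟫ * ⟪G v, t⟫ := by
        rw [← inner_smul_right, ← inner_add_right, ← hvdec]
      rw [this, hGvw, hG v t, hGt, inner_smul_right, real_inner_comm v t]
      ring
    have h2 := hgap w htw
    rw [← hw] at hsq
    have h5 : lam * ‖w‖ ^ 2 = lam * (1 - ⟪t, v⟫ ^ 2) := by rw [hsq]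
    have h6 := mul_nonneg hg.le (sq_nonneg ‖w‖)
    linarith
  have hup : ℓ ≤ lam + δ := by
    have h2 := abs_le.1 (hcs v v)
    rw [inner_sub_left, hCv, inner_smul_left, real_inner_self_eq_norm_sq, hv] at h2
    simp only [RCLike.conj_to_real] at h2
    linarith [h2.2]
  refine ⟨?_, abs_le.2 ⟨by linarith, by linarith⟩⟩
  rw [le_div_iff₀ hg]
  -- Pairing `C v - G v` with `w` gives `(ℓ - lam + g)‖w‖² ≤ δ‖w‖`. With `ℓ ≥ lam - δ` and `‖w‖ ≤ 1`
  -- this yields `g‖w‖² ≤ 2δ‖w‖`.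
  have h2 := abs_le.1 (hcs v w)
  rw [inner_sub_left, hCv, inner_smul_left, hvw, hGvw, hv] at h2
  simp only [RCLike.conj_to_real] at h2
  have h3 := hgap w htw
  have hδ0 : 0 ≤ δ := by
    have := (norm_nonneg _).trans (hδ v)
    rwa [hv, mul_one] at this
  have h4 : g * ‖w‖ ^ 2 ≤ 2 * δ * ‖w‖ := by
    nlinarith [h2.2, norm_nonneg w, mul_nonneg hδ0 (norm_nonneg w)]
  rcases (norm_nonneg w).eq_or_lt with h | h
  · rw [← h]; nlinarith
  · nlinarith

/-- With `c = ⟪t, v⟫` in `[0, 1]`, one has `1 - c ≤ 1 - c²`, the squared length of the orthogonal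
component, and `‖v - t‖² = 2(1 - c)`. The sign hypothesis excludes `v` near `-t`. -/
theorem norm_sub_le_two_mul (ht : ‖t‖ = 1) (hv : ‖v‖ = 1) (hpos : 0 ≤ ⟪t, v⟫) :
    1 - ⟪t, v⟫ ≤ ‖v - ⟪t, v⟫ • t‖ ^ 2 ∧ ‖v - t‖ ≤ 2 * ‖v - ⟪t, v⟫ • t‖ := by
  have hsq := norm_sub_smul_sq ht hv
  have h1 : ⟪t, v⟫ ≤ 1 := by simpa [ht, hv] using real_inner_le_norm t v
  have h2 : 1 - ⟪t, v⟫ ≤ ‖v - ⟪t, v⟫ • t‖ ^ 2 := by nlinarith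
  refine ⟨h2, ?_⟩
  have h3 : ‖v - t‖ ^ 2 = 2 * (1 - ⟪t, v⟫) := by
    rw [norm_sub_sq_real, hv, ht, real_inner_comm]; ring
  exact abs_le_of_sq_le_sq' (by nlinarith) (by positivity) |>.2

/-- First order expansion of a leading eigenvector. -/
theorem norm_sub_add_le (hG : G.IsSymmetric) (ht : ‖t‖ = 1) (hGt : G t = lam • t)
    (hg : 0 < g) (hgap : ∀ v, ⟪t, v⟫ = 0 → ⟪G v, v⟫ ≤ (lam - g) * ‖v‖ ^ 2)
    (hN : ∀ v, N (G v - lam • v) = v - ⟪t, v⟫ • t) (hNt : N t = 0)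
    (hNK : ∀ x, ‖N x‖ ≤ K * ‖x‖)
    (hδ : ∀ x, ‖C x - G x‖ ≤ δ * ‖x‖) (hv : ‖v‖ = 1) (hpos : 0 ≤ ⟪t, v⟫)
    (hCv : C v = ℓ • v) (hmax : ∀ x, ⟪C x, x⟫ ≤ ℓ * ‖x‖ ^ 2) :
    ‖v - t + N (C t - G t)‖ ≤ (4 / g + K) * δ ∧
      ‖v - t + N (C t - G t)‖ ≤ (6 * K / g + 4 / g ^ 2) * δ ^ 2 := by
  obtain ⟨hw, hℓ⟩ := norm_orthogonal_component_le hG ht hGt hg hgap hδ hv hCv hmax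
  obtain ⟨h1, h2⟩ := norm_sub_le_two_mul ht hv hpos
  have hle1 : ⟪t, v⟫ ≤ 1 := by simpa [ht, hv] using real_inner_le_norm t v
  set w := v - ⟪t, v⟫ • t with hwdef
  have hδ0 : 0 ≤ δ := by
    have := (norm_nonneg _).trans (hδ v)
    rwa [hv, mul_one] at this
  have hK0 : 0 ≤ K := by
    have := (norm_nonneg _).trans (hNK v)
    rwa [hv, mul_one] at this
  have hvt : ‖v - t‖ ≤ 4 * δ / g := by
    calc _ ≤ 2 * ‖w‖ := h2
      _ ≤ 2 * (2 * δ / g) := by gcongr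
      _ = _ := by ring
  constructor
  · calc _ ≤ ‖v - t‖ + ‖N (C t - G t)‖ := norm_add_le _ _
      _ ≤ 4 * δ / g + K * (δ * ‖t‖) := add_le_add hvt ((hNK _).trans (by gcongr; exact hδ t))
      _ = _ := by rw [ht]; ring
  · have hNv : N v = N w := by rw [hwdef, map_sub, map_smul, hNt]; simp
    -- Apply `N` to `C v - G v = (ℓ - lam) v - (G v - lam v)`, where `N` sends the last bracket to
    -- `w`.
    have hwN : w = -N (C v - G v) + (ℓ - lam) • N w := by
      rw [← hNv, ← map_smul, ← map_neg, ← map_add, hwdef, ← hN v, hCv]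
      congr 1
      module
    -- Replacing `v` by `t` in the linear term leaves three errors, each a product of two factors of
    -- order `δ`.
    have key : v - t + N (C t - G t)
        = -N (C (v - t) - G (v - t)) + (ℓ - lam) • N w - (1 - ⟪t, v⟫) • t := by
      have : v - t = w - (1 - ⟪t, v⟫) • t := by rw [hwdef]; module
      calc v - t + N (C t - G t)
          = w - (1 - ⟪t, v⟫) • t + N (C t - G t) := by rw [this]
        _ = -N (C v - G v) + (ℓ - lam) • N w - (1 - ⟪t, v⟫) • t + N (C t - G t) := by
            rw [← hwN]
        _ = _ := by simp only [map_sub]; abel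
    rw [key]
    have e1 : ‖N (C (v - t) - G (v - t))‖ ≤ K * (δ * (4 * δ / g)) :=
      (hNK _).trans (by gcongr; exact (hδ _).trans (by gcongr))
    have e2 : ‖(ℓ - lam) • N w‖ ≤ δ * (K * (2 * δ / g)) := by
      rw [norm_smul, Real.norm_eq_abs]
      gcongr
      exact (hNK _).trans (by gcongr)
    have e3 : ‖(1 - ⟪t, v⟫) • t‖ ≤ (2 * δ / g) ^ 2 := by
      rw [norm_smul, ht, mul_one, Real.norm_eq_abs, abs_of_nonneg (by linarith)]
      exact h1.trans (by gcongr)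
    calc _ ≤ ‖N (C (v - t) - G (v - t))‖ + ‖(ℓ - lam) • N w‖ + ‖(1 - ⟪t, v⟫) • t‖ := by
          refine (norm_sub_le _ _).trans ?_
          gcongr
          refine (norm_add_le _ _).trans ?_
          rw [norm_neg]
      _ ≤ _ := add_le_add (add_le_add e1 e2) e3
      _ = _ := by ring

end Perturbation

/-! ### Pseudoinverse of a symmetric matrix -/

section PinvSymm

variable {n : ℕ} {M : Matrix (Fin n) (Fin n) ℝ}

theorem pinv_transpose (hM : Mᵀ = M) : (pinv M)ᵀ = pinv M := by
  have h := isMoorePenrose_pinv M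
  refine IsMoorePenrose.unique (M := M) ⟨?_, ?_, ?_, ?_⟩ h
  · have := congrArg Matrix.transpose h.mul_mul_left
    simpa [Matrix.transpose_mul, hM, Matrix.mul_assoc] using this
  · have := congrArg Matrix.transpose h.mul_mul_right
    simpa [Matrix.transpose_mul, hM, Matrix.mul_assoc] using this
  · have := h.symm_right
    simp only [Matrix.transpose_mul, hM] at this
    simp [Matrix.transpose_mul, hM, this]
  · have := h.symm_left
    simp only [Matrix.transpose_mul, hM] at this
    simp [Matrix.transpose_mul, hM, this]

/-- A symmetric `M` commutes with its pseudoinverse, so `pinv M = (pinv M)² M`. -/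
theorem pinv_mulVec_eq_zero (hM : Mᵀ = M) {x : Fin n → ℝ} (hx : M *ᵥ x = 0) :
    pinv M *ᵥ x = 0 := by
  have h := isMoorePenrose_pinv M
  have hs := h.symm_left
  rw [Matrix.transpose_mul, hM, pinv_transpose hM] at hs
  rw [← h.mul_mul_right, Matrix.mul_assoc, ← hs, ← Matrix.mul_assoc, ← Matrix.mulVec_mulVec, hx,
    Matrix.mulVec_zero]

end PinvSymm

/-! ### Moments of Gaussian vectors -/

section GaussianMoments

open scoped RealInnerProductSpace

variable {p : ℕ} {S : Matrix (Fin p) (Fin p) ℝ}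

theorem inner_eq_dotProduct_ofLp (a b : EuclideanSpace ℝ (Fin p)) :
    ⟪a, b⟫ = a.ofLp ⬝ᵥ b.ofLp := by
  simp [PiLp.inner_apply, dotProduct, mul_comm]

theorem inner_single_one (i : Fin p) (x : EuclideanSpace ℝ (Fin p)) :
    ⟪EuclideanSpace.single i (1 : ℝ), x⟫ = x i := by
  simp [inner_eq_dotProduct_ofLp]

theorem memLp_inner_sub (ν : Measure (EuclideanSpace ℝ (Fin p))) [IsGaussian ν]
    (a m : EuclideanSpace ℝ (Fin p)) {q : ENNReal} (hq : q ≠ ⊤) :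
    MemLp (fun x => ⟪a, x - m⟫) q ν :=
  ((IsGaussian.memLp_id ν q hq).sub (memLp_const m)).const_inner a

theorem memLp_two_inner_mul_inner (ν : Measure (EuclideanSpace ℝ (Fin p))) [IsGaussian ν]
    (a b m : EuclideanSpace ℝ (Fin p)) :
    MemLp (fun x => ⟪a, x - m⟫ * ⟪b, x - m⟫) 2 ν := by
  have : ENNReal.HolderTriple 4 4 2 := ⟨by
    rw [← two_mul, show (4 : ENNReal) = 2 * 2 by norm_num,
      ENNReal.mul_inv (by simp) (by simp), ← mul_assoc, ENNReal.mul_inv_cancel (by simp) (by simp),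
      one_mul]⟩
  exact MemLp.mul (memLp_inner_sub ν b m (q := 4) (by simp))
    (memLp_inner_sub ν a m (q := 4) (by simp))

theorem integral_inner_sub_multivariateGaussian (μ a m : EuclideanSpace ℝ (Fin p)) :
    ∫ x, ⟪a, x - m⟫ ∂(multivariateGaussian μ S) = ⟪a, μ - m⟫ := by
  rw [integral_inner]
  · rw [integral_sub IsGaussian.integrable_fun_id (integrable_const _)]
    simp
  · exact IsGaussian.integrable_fun_id.sub (integrable_const _)

theorem covariance_inner_sub_multivariateGaussian (hS : S.PosSemidef)
    (μ a b m : EuclideanSpace ℝ (Fin p)) :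
    cov[fun x => ⟪a, x - m⟫, fun x => ⟪b, x - m⟫; multivariateGaussian μ S]
      = a.ofLp ⬝ᵥ S *ᵥ b.ofLp := by
  rw [← covarianceBilin_multivariateGaussian (μ := μ) hS,
    covarianceBilin_apply_eq_cov IsGaussian.memLp_two_id]
  have hint : ∀ a : EuclideanSpace ℝ (Fin p),
      Integrable (fun x => ⟪a, x⟫) (multivariateGaussian μ S) := fun a =>
    IsGaussian.integrable_fun_id.const_inner a
  simp only [inner_sub_right]
  rw [covariance_sub_const_left (hint a), covariance_sub_const_right (hint b)]

theorem integral_inner_mul_inner_multivariateGaussian (hS : S.PosSemidef)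
    (μ a b m : EuclideanSpace ℝ (Fin p)) :
    ∫ x, ⟪a, x - m⟫ * ⟪b, x - m⟫ ∂(multivariateGaussian μ S)
      = a.ofLp ⬝ᵥ S *ᵥ b.ofLp + ⟪a, μ - m⟫ * ⟪b, μ - m⟫ := by
  have h := covariance_eq_sub (memLp_inner_sub (multivariateGaussian μ S) a m (q := 2) (by simp))
    (memLp_inner_sub (multivariateGaussian μ S) b m (q := 2) (by simp))
  rw [covariance_inner_sub_multivariateGaussian hS, integral_inner_sub_multivariateGaussian,
    integral_inner_sub_multivariateGaussian] at h
  simp only [Pi.mul_apply] at h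
  linarith

/-- Fourth order moment of a Gaussian vector in two uncorrelated directions. -/
theorem integral_sq_inner_mul_inner_multivariateGaussian (hS : S.PosSemidef)
    {μ b t m : EuclideanSpace ℝ (Fin p)} (hb : ⟪b, μ - m⟫ = 0)
    (hbt : b.ofLp ⬝ᵥ S *ᵥ t.ofLp = 0) :
    ∫ x, (⟪b, x - m⟫ * ⟪t, x - m⟫) ^ 2 ∂(multivariateGaussian μ S)
      = (b.ofLp ⬝ᵥ S *ᵥ b.ofLp) * ∫ x, ⟪t, x - m⟫ * ⟪t, x - m⟫ ∂(multivariateGaussian μ S) := by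
  set ν := multivariateGaussian μ S
  -- The two projections are jointly Gaussian, so zero covariance makes them independent and the
  -- integral factors. Only the projection on `b` has to be centred at `m`.
  have hg : HasGaussianLaw (fun x => (⟪b, x⟫, ⟪t, x⟫)) ν :=
    IsGaussian.hasGaussianLaw_id.map_fun ((innerSL ℝ b).prod (innerSL ℝ t))
  have hcov : cov[fun x => ⟪b, x⟫, fun x => ⟪t, x⟫; ν] = 0 := by
    simpa [hbt] using covariance_inner_sub_multivariateGaussian hS μ b t 0
  have hind : IndepFun (fun x => ⟪b, x⟫) (fun x => ⟪t, x⟫) ν :=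
    hg.indepFun_of_covariance_eq_zero hcov
  have hind2 := hind.comp (φ := fun y : ℝ => (y - ⟪b, m⟫) ^ 2) (ψ := fun y : ℝ => (y - ⟪t, m⟫) ^ 2)
    (by fun_prop) (by fun_prop)
  have h := hind2.integral_mul_eq_mul_integral (by fun_prop) (by fun_prop)
  have h2 := integral_inner_mul_inner_multivariateGaussian hS μ b b m
  rw [hb, mul_zero, add_zero] at h2
  rw [← h2]
  simp only [Function.comp_def, Pi.mul_apply, ← inner_sub_right] at h
  simp only [mul_pow, ← pow_two]
  exact h

end GaussianMoments

/-! ### Moments of the mixture -/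

section MixtureMoments

open scoped RealInnerProductSpace

variable {p : ℕ} {S : Matrix (Fin p) (Fin p) ℝ} {α₁ : ℝ} {μ₁ μ₂ : EuclideanSpace ℝ (Fin p)}

theorem isProbabilityMeasure_mixture (hα₀ : 0 ≤ α₁) (hα₁ : α₁ ≤ 1) :
    IsProbabilityMeasure (mixture α₁ μ₁ μ₂ S) := by
  constructor
  simp only [mixture, Measure.coe_add, Measure.coe_smul, Pi.add_apply, Pi.smul_apply, measure_univ,
    smul_eq_mul, mul_one]
  rw [← ENNReal.ofReal_add hα₀ (by linarith)]
  simp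

theorem integrable_mixture {F : Type*} [NormedAddCommGroup F] {f : EuclideanSpace ℝ (Fin p) → F}
    (h1 : Integrable f (multivariateGaussian μ₁ S))
    (h2 : Integrable f (multivariateGaussian μ₂ S)) : Integrable f (mixture α₁ μ₁ μ₂ S) :=
  (h1.smul_measure ENNReal.ofReal_ne_top).add_measure (h2.smul_measure ENNReal.ofReal_ne_top)

theorem integral_mixture {F : Type*} [NormedAddCommGroup F] [NormedSpace ℝ F]
    (hα₀ : 0 ≤ α₁) (hα₁ : α₁ ≤ 1) {f : EuclideanSpace ℝ (Fin p) → F}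
    (h1 : Integrable f (multivariateGaussian μ₁ S))
    (h2 : Integrable f (multivariateGaussian μ₂ S)) :
    ∫ x, f x ∂(mixture α₁ μ₁ μ₂ S) = α₁ • ∫ x, f x ∂(multivariateGaussian μ₁ S)
      + (1 - α₁) • ∫ x, f x ∂(multivariateGaussian μ₂ S) := by
  rw [mixture, integral_add_measure (h1.smul_measure ENNReal.ofReal_ne_top)
    (h2.smul_measure ENNReal.ofReal_ne_top), integral_smul_measure, integral_smul_measure,
    ENNReal.toReal_ofReal hα₀, ENNReal.toReal_ofReal (by linarith)]

theorem memLp_two_mixture {f : EuclideanSpace ℝ (Fin p) → ℝ} (hf : Continuous f)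
    (h1 : MemLp f 2 (multivariateGaussian μ₁ S))
    (h2 : MemLp f 2 (multivariateGaussian μ₂ S)) : MemLp f 2 (mixture α₁ μ₁ μ₂ S) :=
  (memLp_two_iff_integrable_sq hf.aestronglyMeasurable).2
    (integrable_mixture h1.integrable_sq h2.integrable_sq)

theorem memLp_two_inner_mixture (a m : EuclideanSpace ℝ (Fin p)) :
    MemLp (fun x => ⟪a, x - m⟫) 2 (mixture α₁ μ₁ μ₂ S) :=
  memLp_two_mixture (by fun_prop) (memLp_inner_sub _ a m (by simp))
    (memLp_inner_sub _ a m (by simp))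

theorem memLp_two_inner_mul_inner_mixture (a b m : EuclideanSpace ℝ (Fin p)) :
    MemLp (fun x => ⟪a, x - m⟫ * ⟪b, x - m⟫) 2 (mixture α₁ μ₁ μ₂ S) :=
  memLp_two_mixture (by fun_prop) (memLp_two_inner_mul_inner _ a b m)
    (memLp_two_inner_mul_inner _ a b m)

theorem integral_id_mixture (hα₀ : 0 ≤ α₁) (hα₁ : α₁ ≤ 1) :
    ∫ x, x ∂(mixture α₁ μ₁ μ₂ S) = α₁ • μ₁ + (1 - α₁) • μ₂ := by
  rw [integral_mixture hα₀ hα₁ IsGaussian.integrable_fun_id IsGaussian.integrable_fun_id]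
  simp

theorem sub_integral_id_mixture (hα₀ : 0 ≤ α₁) (hα₁ : α₁ ≤ 1) :
    μ₁ - ∫ x, x ∂(mixture α₁ μ₁ μ₂ S) = -(1 - α₁) • (μ₂ - μ₁) ∧
    μ₂ - ∫ x, x ∂(mixture α₁ μ₁ μ₂ S) = α₁ • (μ₂ - μ₁) := by
  rw [integral_id_mixture hα₀ hα₁]
  constructor <;> module

theorem dotProduct_hhT_mulVec (a b : EuclideanSpace ℝ (Fin p)) :
    a.ofLp ⬝ᵥ hhT μ₁ μ₂ *ᵥ b.ofLp = ⟪a, μ₂ - μ₁⟫ * ⟪b, μ₂ - μ₁⟫ := by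
  rw [hhT, Matrix.vecMulVec_mulVec]
  rw [dotProduct_smul, inner_eq_dotProduct_ofLp, inner_eq_dotProduct_ofLp, dotProduct_comm b.ofLp]
  simp

/-- The component means deviate from the overall mean by `-α₂ h` and `α₁ h`. The between-component
part thus has weight `α₁ α₂² + α₂ α₁² = β`. -/
theorem integral_inner_mul_inner_mixture (hα₀ : 0 ≤ α₁) (hα₁ : α₁ ≤ 1) (hS : S.PosSemidef)
    (a b : EuclideanSpace ℝ (Fin p)) :
    ∫ x, ⟪a, x - ∫ z, z ∂(mixture α₁ μ₁ μ₂ S)⟫ * ⟪b, x - ∫ z, z ∂(mixture α₁ μ₁ μ₂ S)⟫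
        ∂(mixture α₁ μ₁ μ₂ S)
      = a.ofLp ⬝ᵥ (S + beta α₁ • hhT μ₁ μ₂) *ᵥ b.ofLp := by
  obtain ⟨e1, e2⟩ := sub_integral_id_mixture (μ₁ := μ₁) (μ₂ := μ₂) (S := S) hα₀ hα₁
  rw [integral_mixture hα₀ hα₁ ((memLp_two_inner_mul_inner _ a b _).integrable (by simp))
      ((memLp_two_inner_mul_inner _ a b _).integrable (by simp)),
    integral_inner_mul_inner_multivariateGaussian hS,
    integral_inner_mul_inner_multivariateGaussian hS, e1, e2, Matrix.add_mulVec, dotProduct_add,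
    Matrix.smul_mulVec, dotProduct_smul, dotProduct_hhT_mulVec]
  simp only [inner_smul_right, smul_eq_mul, beta]
  ring

/-- A direction `b` orthogonal to `h` does not see the difference of the components: it is centred
with the same variance in both. This variance factors out of the average over components, leaving
the second moment of the mixture along `t`. -/
theorem integral_sq_inner_mul_inner_mixture (hα₀ : 0 ≤ α₁) (hα₁ : α₁ ≤ 1) (hS : S.PosSemidef)
    {b t : EuclideanSpace ℝ (Fin p)} (hb : ⟪b, μ₂ - μ₁⟫ = 0)
    (hbt : b.ofLp ⬝ᵥ S *ᵥ t.ofLp = 0) :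
    ∫ x, (⟪b, x - ∫ z, z ∂(mixture α₁ μ₁ μ₂ S)⟫ * ⟪t, x - ∫ z, z ∂(mixture α₁ μ₁ μ₂ S)⟫) ^ 2
        ∂(mixture α₁ μ₁ μ₂ S)
      = (b.ofLp ⬝ᵥ S *ᵥ b.ofLp) * (t.ofLp ⬝ᵥ (S + beta α₁ • hhT μ₁ μ₂) *ᵥ t.ofLp) := by
  obtain ⟨e1, e2⟩ := sub_integral_id_mixture (μ₁ := μ₁) (μ₂ := μ₂) (S := S) hα₀ hα₁
  rw [← integral_inner_mul_inner_mixture hα₀ hα₁ hS t t]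
  set m := ∫ z, z ∂(mixture α₁ μ₁ μ₂ S)
  rw [integral_mixture hα₀ hα₁ (memLp_two_inner_mul_inner _ b t _).integrable_sq
      (memLp_two_inner_mul_inner _ b t _).integrable_sq,
    integral_mixture hα₀ hα₁ ((memLp_two_inner_mul_inner _ t t _).integrable (by simp))
      ((memLp_two_inner_mul_inner _ t t _).integrable (by simp)),
    integral_sq_inner_mul_inner_multivariateGaussian hS (by rw [e1, inner_smul_right, hb, mul_zero])
      hbt,
    integral_sq_inner_mul_inner_multivariateGaussian hS (by rw [e2, inner_smul_right, hb, mul_zero])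
      hbt]
  simp only [smul_eq_mul]
  ring

theorem covMatrix_mixture (hα₀ : 0 ≤ α₁) (hα₁ : α₁ ≤ 1) (hS : S.PosSemidef) :
    covMatrix (mixture α₁ μ₁ μ₂ S) = S + beta α₁ • hhT μ₁ μ₂ := by
  ext i j
  have h := integral_inner_mul_inner_mixture (μ₁ := μ₁) (μ₂ := μ₂) hα₀ hα₁ hS
    (EuclideanSpace.single i 1) (EuclideanSpace.single j 1)
  have hint : Integrable (fun x : EuclideanSpace ℝ (Fin p) => x) (mixture α₁ μ₁ μ₂ S) :=
    integrable_mixture IsGaussian.integrable_fun_id IsGaussian.integrable_fun_id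
  have hm : ∀ i, ∫ x, x i ∂(mixture α₁ μ₁ μ₂ S) = (∫ x, x ∂(mixture α₁ μ₁ μ₂ S)) i := fun i =>
    (EuclideanSpace.proj (𝕜 := ℝ) i).integral_comp_comm hint
  rw [covMatrix, Matrix.of_apply, covariance]
  simp only [hm]
  simpa [Matrix.add_mulVec, Matrix.smul_mulVec, inner_single_one] using h

end MixtureMoments

/-! ### The leading eigenspace of the covariance matrix -/

section LeadingEigenspace

open scoped RealInnerProductSpace

/-- If an eigenvalue exceeds the second largest one, it is the largest and it is simple. -/
theorem eigenvalue_le_and_simple_of_second_lt {E : Type*} [NormedAddCommGroup E]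
    [InnerProductSpace ℝ E] [FiniteDimensional ℝ E] {n : ℕ} {T : E →ₗ[ℝ] E} (hT : T.IsSymmetric)
    (hn : Module.finrank ℝ E = n) {lam : ℝ} {t : E} (ht : t ≠ 0) (hTt : T t = lam • t)
    (hlt : ∀ h : 1 < n, hT.eigenvalues hn ⟨1, h⟩ < lam) :
    (∀ a : ℝ, Module.End.HasEigenvalue T a → a ≤ lam) ∧
      ∀ v, T v = lam • v → ∃ r : ℝ, v = r • t := by
  obtain ⟨i, hi⟩ := hT.exists_eigenvalues_eq hn (μ := lam)
    (Module.End.hasEigenvalue_of_hasEigenvector ⟨Module.End.mem_eigenspace_iff.2 hTt, ht⟩)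
  have hi' : hT.eigenvalues hn i = lam := hi
  have hlt' : ∀ j : Fin n, j.val ≠ 0 → hT.eigenvalues hn j < lam := by
    intro j hj
    have h1 : 1 < n := by have := j.2; omega
    refine lt_of_le_of_lt (hT.eigenvalues_antitone hn ?_) (hlt h1)
    rw [Fin.le_def]
    exact Nat.one_le_iff_ne_zero.2 hj
  have hi0 : i.val = 0 := by
    by_contra h
    exact (hlt' i h).ne hi'
  -- Every other basis vector has eigenvalue different from `lam`, hence is orthogonal to `v`.
  have hexp : ∀ v, T v = lam • v → v = ⟪hT.eigenvectorBasis hn i, v⟫ • hT.eigenvectorBasis hn i := by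
    intro v hv
    conv_lhs => rw [← (hT.eigenvectorBasis hn).sum_repr' v]
    refine Finset.sum_eq_single_of_mem i (Finset.mem_univ _) fun j _ hj => ?_
    have hj0 : j.val ≠ 0 := fun h => hj (Fin.ext (h.trans hi0.symm))
    have h2 := hT (hT.eigenvectorBasis hn j) v
    rw [hT.apply_eigenvectorBasis hn j, hv, inner_smul_left, inner_smul_right] at h2
    have h3 : (hT.eigenvalues hn j - lam) * ⟪hT.eigenvectorBasis hn j, v⟫ = 0 := by
      rw [sub_mul, sub_eq_zero]
      exact h2
    rcases mul_eq_zero.1 h3 with h | h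
    · exact absurd (sub_eq_zero.1 h) (hlt' j hj0).ne
    · rw [h, zero_smul]
  constructor
  · intro a ha
    obtain ⟨j, hj⟩ := hT.exists_eigenvalues_eq hn ha
    have hj' : hT.eigenvalues hn j = a := hj
    rw [← hj', ← hi']
    refine hT.eigenvalues_antitone hn ?_
    rw [Fin.le_def, hi0]
    exact Nat.zero_le _
  · intro v hv
    have h1 := hexp t hTt
    have h2 := hexp v hv
    have h3 : ⟪hT.eigenvectorBasis hn i, t⟫ ≠ 0 := by
      intro h
      rw [h, zero_smul] at h1
      exact ht h1
    refine ⟨⟪hT.eigenvectorBasis hn i, v⟫ / ⟪hT.eigenvectorBasis hn i, t⟫, ?_⟩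
    rw [h1, smul_smul, ← h1, div_mul_cancel₀ _ h3]
    exact h2

variable {p : ℕ}

theorem ofLp_toEuclideanLin_eq_mulVec (A : Matrix (Fin p) (Fin p) ℝ)
    (x : EuclideanSpace ℝ (Fin p)) : (Matrix.toEuclideanLin A x).ofLp = A *ᵥ x.ofLp := rfl

theorem toEuclideanLin_mul_apply (A B : Matrix (Fin p) (Fin p) ℝ) (x : EuclideanSpace ℝ (Fin p)) :
    Matrix.toEuclideanLin (A * B) x = Matrix.toEuclideanLin A (Matrix.toEuclideanLin B x) := by
  ext i
  simp [Matrix.mulVec_mulVec]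

theorem inner_toEuclideanLin (A : Matrix (Fin p) (Fin p) ℝ) (x y : EuclideanSpace ℝ (Fin p)) :
    ⟪x, Matrix.toEuclideanLin A y⟫ = x.ofLp ⬝ᵥ A *ᵥ y.ofLp := by
  rw [inner_eq_dotProduct_ofLp, ofLp_toEuclideanLin_eq_mulVec]

theorem toEuclideanLin_hhT_apply (μ₁ μ₂ x : EuclideanSpace ℝ (Fin p)) :
    Matrix.toEuclideanLin (hhT μ₁ μ₂) x = ⟪x, μ₂ - μ₁⟫ • (μ₂ - μ₁) := by
  ext i
  rw [ofLp_toEuclideanLin_eq_mulVec, hhT, Matrix.vecMulVec_mulVec, inner_eq_dotProduct_ofLp,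
    dotProduct_comm x.ofLp]
  simp [mul_comm]

variable {S : Matrix (Fin p) (Fin p) ℝ} {α₁ : ℝ} {μ₁ μ₂ : EuclideanSpace ℝ (Fin p)}

theorem toEuclideanLin_theta (hS : S.PosDef) :
    Matrix.toEuclideanLin S (theta μ₁ μ₂ S) = μ₂ - μ₁ := by
  rw [theta, ← toEuclideanLin_mul_apply,
    Matrix.mul_nonsing_inv _ ((Matrix.isUnit_iff_isUnit_det _).1 hS.isUnit)]
  ext i
  simp

theorem tau_eq_inner : tau μ₁ μ₂ S = ⟪theta μ₁ μ₂ S, μ₂ - μ₁⟫ := by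
  rw [tau, real_inner_comm, theta, inner_toEuclideanLin]

theorem theta_ne_zero (hμ : μ₁ ≠ μ₂) (hS : S.PosDef) : theta μ₁ μ₂ S ≠ 0 := by
  intro h
  have := toEuclideanLin_theta (μ₁ := μ₁) (μ₂ := μ₂) hS
  rw [h, map_zero] at this
  exact hμ (sub_eq_zero.1 this.symm).symm

theorem inner_toEuclideanLin_self_pos (hS : S.PosDef) {x : EuclideanSpace ℝ (Fin p)}
    (hx : x ≠ 0) : 0 < ⟪x, Matrix.toEuclideanLin S x⟫ := by
  rw [inner_toEuclideanLin]
  have := hS.dotProduct_mulVec_pos (x := x.ofLp) (by simpa using hx)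
  simpa using this

theorem tau_pos (hμ : μ₁ ≠ μ₂) (hS : S.PosDef) : 0 < tau μ₁ μ₂ S := by
  rw [tau_eq_inner, ← toEuclideanLin_theta hS]
  exact inner_toEuclideanLin_self_pos hS (theta_ne_zero hμ hS)

theorem beta_pos (hα₀ : 0 < α₁) (hα₁ : α₁ < 1) : 0 < beta α₁ :=
  mul_pos hα₀ (by linarith)

/-- No condition on the eigenvectors is needed here. The identity links the two alternatives: `θ` is
an eigenvector of the covariance matrix exactly when `h` is parallel to `θ`. -/
theorem toEuclideanLin_cov_theta (hS : S.PosDef) :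
    Matrix.toEuclideanLin (S + beta α₁ • hhT μ₁ μ₂) (theta μ₁ μ₂ S)
      = (1 + beta α₁ * tau μ₁ μ₂ S) • (μ₂ - μ₁) := by
  rw [map_add, map_smul, LinearMap.add_apply, LinearMap.smul_apply, toEuclideanLin_theta hS,
    toEuclideanLin_hhT_apply, ← tau_eq_inner]
  module

theorem norm_thetaDir (hμ : μ₁ ≠ μ₂) (hS : S.PosDef) : ‖thetaDir μ₁ μ₂ S‖ = 1 := by
  rw [thetaDir, norm_smul, norm_inv, norm_norm,
    inv_mul_cancel₀ (norm_ne_zero_iff.2 (theta_ne_zero hμ hS))]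

theorem eq_smul_of_uniqueLeading {E : Type*} [NormedAddCommGroup E] [NormedSpace ℝ E]
    {T : E →ₗ[ℝ] E} {lam : ℝ} {t : E}
    (h : ∀ v, ‖v‖ = 1 → T v = lam • v → v = t ∨ v = -t) {v : E} (hv : T v = lam • v) :
    ∃ r : ℝ, v = r • t := by
  by_cases h0 : v = 0
  · exact ⟨0, by simp [h0]⟩
  have hn : ‖v‖ ≠ 0 := norm_ne_zero_iff.2 h0
  have h1 : v = ‖v‖ • (‖v‖⁻¹ • v) := by rw [smul_smul, mul_inv_cancel₀ hn, one_smul]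
  rcases h (‖v‖⁻¹ • v) (by rw [norm_smul, norm_inv, norm_norm, inv_mul_cancel₀ hn])
    (by rw [map_smul, hv, smul_comm]) with h2 | h2
  · exact ⟨‖v‖, by rw [← h2]; exact h1⟩
  · exact ⟨-‖v‖, by rw [neg_smul, ← smul_neg, ← h2]; exact h1⟩

/-- Under either condition, the discriminant direction spans the eigenspace of the largest
eigenvalue of the covariance matrix, and it is an eigenvector of `S` parallel to `μ₂ - μ₁`. -/
theorem exists_leading_eigenvalue (hα₀ : 0 < α₁) (hα₁ : α₁ < 1) (hμ : μ₁ ≠ μ₂) (hS : S.PosDef)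
    (hcond : EigenvalueCondition α₁ μ₁ μ₂ S ∨ UniqueLeadingCondition α₁ μ₁ μ₂ S) :
    ∃ φ lam : ℝ, 0 < φ ∧ lam = φ * (1 + beta α₁ * tau μ₁ μ₂ S) ∧
      μ₂ - μ₁ = φ • theta μ₁ μ₂ S ∧
      Matrix.toEuclideanLin (covMatrix (mixture α₁ μ₁ μ₂ S)) (thetaDir μ₁ μ₂ S)
        = lam • thetaDir μ₁ μ₂ S ∧
      (∀ a : ℝ, Module.End.HasEigenvalue
        (Matrix.toEuclideanLin (covMatrix (mixture α₁ μ₁ μ₂ S))) a → a ≤ lam) ∧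
      ∀ v, Matrix.toEuclideanLin (covMatrix (mixture α₁ μ₁ μ₂ S)) v = lam • v →
        ∃ r : ℝ, v = r • thetaDir μ₁ μ₂ S := by
  have hh : μ₂ - μ₁ ≠ 0 := sub_ne_zero.2 hμ.symm
  have hθ := theta_ne_zero hμ hS
  have ht1 := norm_thetaDir hμ hS
  have ht0 : thetaDir μ₁ μ₂ S ≠ 0 := by
    intro h
    rw [h, norm_zero] at ht1
    exact zero_ne_one ht1
  have hbt : 0 < 1 + beta α₁ * tau μ₁ μ₂ S := by
    have := mul_pos (beta_pos hα₀ hα₁) (tau_pos hμ hS)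
    linarith
  have hθt : theta μ₁ μ₂ S = ‖theta μ₁ μ₂ S‖ • thetaDir μ₁ μ₂ S := by
    rw [thetaDir, smul_smul, mul_inv_cancel₀ (norm_ne_zero_iff.2 hθ), one_smul]
  have hcov := covMatrix_mixture (μ₁ := μ₁) (μ₂ := μ₂) hα₀.le hα₁.le hS.posSemidef
  -- Positivity comes from `τ = φ‖θ‖² > 0`.
  have hφpos : ∀ φ : ℝ, μ₂ - μ₁ = φ • theta μ₁ μ₂ S → 0 < φ := by
    intro φ hφ
    have h1 := tau_pos hμ hS
    rw [tau_eq_inner, hφ, inner_smul_right, real_inner_self_eq_norm_sq] at h1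
    exact pos_of_mul_pos_left h1 (sq_nonneg _)
  have hTt : ∀ φ : ℝ, μ₂ - μ₁ = φ • theta μ₁ μ₂ S →
      Matrix.toEuclideanLin (covMatrix (mixture α₁ μ₁ μ₂ S)) (thetaDir μ₁ μ₂ S)
        = (φ * (1 + beta α₁ * tau μ₁ μ₂ S)) • thetaDir μ₁ μ₂ S := by
    intro φ hφ
    rw [hcov, thetaDir, map_smul, toEuclideanLin_cov_theta hS, hφ]
    module
  rcases hcond with ⟨φ, hφ, hlt⟩ | huniq
  · have h1 : Matrix.toEuclideanLin S (μ₂ - μ₁) = φ • (μ₂ - μ₁) :=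
      Module.End.mem_eigenspace_iff.1 hφ.1
    have h2 : μ₂ - μ₁ = φ • theta μ₁ μ₂ S := by
      have h3 : theta μ₁ μ₂ S = Matrix.toEuclideanLin S⁻¹ (μ₂ - μ₁) := rfl
      rw [h3, ← map_smul, ← h1, ← toEuclideanLin_mul_apply,
        Matrix.nonsing_inv_mul _ ((Matrix.isUnit_iff_isUnit_det _).1 hS.isUnit)]
      ext i
      simp
    refine ⟨φ, _, hφpos φ h2, rfl, h2, hTt φ h2, ?_⟩
    exact eigenvalue_le_and_simple_of_second_lt
      (Matrix.isSymmetric_toEuclideanLin_iff.2 (covMatrix_isHermitian _)) finrank_euclideanSpace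
      ht0 (hTt φ h2) hlt
  · obtain ⟨-, lam, hlam, hmax⟩ := (huniq _).2 (Or.inl rfl)
    have h1 := Module.End.mem_eigenspace_iff.1 hlam.1
    -- The two expressions `lam • θ` and `(1 + βτ) • h` for the image of `θ` are compared.
    have h2 : μ₂ - μ₁ = (lam / (1 + beta α₁ * tau μ₁ μ₂ S)) • theta μ₁ μ₂ S := by
      have h3 : Matrix.toEuclideanLin (covMatrix (mixture α₁ μ₁ μ₂ S)) (theta μ₁ μ₂ S)
          = lam • theta μ₁ μ₂ S := by
        rw [hθt, map_smul, h1, smul_comm]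
      rw [hcov, toEuclideanLin_cov_theta hS] at h3
      rw [div_eq_inv_mul, ← smul_smul, ← h3, smul_smul, inv_mul_cancel₀ hbt.ne', one_smul]
    have h4 : lam = lam / (1 + beta α₁ * tau μ₁ μ₂ S) * (1 + beta α₁ * tau μ₁ μ₂ S) := by
      rw [div_mul_cancel₀ _ hbt.ne']
    refine ⟨_, lam, hφpos _ h2, h4, h2, h1, hmax, fun v hv => ?_⟩
    refine eq_smul_of_uniqueLeading (fun v hv1 hv => (huniq v).1 ⟨hv1, lam, ?_, hmax⟩) hv
    refine ⟨Module.End.mem_eigenspace_iff.2 hv, fun h => ?_⟩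
    rw [h, norm_zero] at hv1
    exact zero_ne_one hv1

end LeadingEigenspace

/-! ### The reduced resolvent and the limiting covariance -/

section LimitCovariance

open scoped RealInnerProductSpace

variable {p : ℕ}

/-- The kernel of `A - lam I` is the line through `t`, so the pseudoinverse inverts this matrix on
the orthogonal complement of `t` and vanishes at `t`. This provides the operator `N` of
`norm_sub_add_le`. -/
theorem pinv_apply_sub_smul {A : Matrix (Fin p) (Fin p) ℝ} (hA : A.IsHermitian)
    {t : EuclideanSpace ℝ (Fin p)} {lam : ℝ} (ht : ‖t‖ = 1)
    (hAt : Matrix.toEuclideanLin A t = lam • t)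
    (hsimple : ∀ v, Matrix.toEuclideanLin A v = lam • v → ∃ r : ℝ, v = r • t) :
    Matrix.toEuclideanLin (pinv (A - lam • (1 : Matrix (Fin p) (Fin p) ℝ))) t = 0 ∧
    (pinv (A - lam • (1 : Matrix (Fin p) (Fin p) ℝ)))ᵀ
      = pinv (A - lam • (1 : Matrix (Fin p) (Fin p) ℝ)) ∧
    ∀ v, Matrix.toEuclideanLin (pinv (A - lam • (1 : Matrix (Fin p) (Fin p) ℝ)))
      (Matrix.toEuclideanLin A v - lam • v) = v - ⟪t, v⟫ • t := by
  set M := A - lam • (1 : Matrix (Fin p) (Fin p) ℝ) with hM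
  have hMs : Mᵀ = M := by
    have : Aᵀ = A := by simpa [Matrix.conjTranspose_eq_transpose_of_trivial] using hA.eq
    simp [hM, this]
  have hMv : ∀ v, Matrix.toEuclideanLin M v = Matrix.toEuclideanLin A v - lam • v := by
    intro v
    rw [hM, map_sub, map_smul, LinearMap.sub_apply, LinearMap.smul_apply]
    congr 2
    ext i
    simp
  have hNs := pinv_transpose hMs
  have hNt : Matrix.toEuclideanLin (pinv M) t = 0 := by
    have h0 : M *ᵥ t.ofLp = 0 := by
      rw [← ofLp_toEuclideanLin_eq_mulVec, hMv, hAt, sub_self]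
      rfl
    ext i
    rw [ofLp_toEuclideanLin_eq_mulVec, pinv_mulVec_eq_zero hMs h0]
    rfl
  have hNsymm : (Matrix.toEuclideanLin (pinv M)).IsSymmetric := by
    rw [Matrix.isSymmetric_toEuclideanLin_iff, Matrix.IsHermitian,
      Matrix.conjTranspose_eq_transpose_of_trivial, hNs]
  refine ⟨hNt, hNs, fun v => ?_⟩
  rw [← hMv]
  set y := Matrix.toEuclideanLin (pinv M) (Matrix.toEuclideanLin M v) with hy
  -- By the first Penrose condition `y - v` lies in the kernel, so it is a multiple of `t`. The
  -- coefficient follows from `⟪t, y⟫ = 0`.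
  have h1 : Matrix.toEuclideanLin M (y - v) = 0 := by
    rw [map_sub, hy, ← toEuclideanLin_mul_apply, ← toEuclideanLin_mul_apply,
      (isMoorePenrose_pinv M).mul_mul_left, sub_self]
  obtain ⟨r, hr⟩ := hsimple (y - v) (by rw [hMv, sub_eq_zero] at h1; exact h1)
  have h2 : ⟪t, y⟫ = 0 := by
    rw [hy, ← hNsymm, hNt, inner_zero_left]
  have h3 : r = -⟪t, v⟫ := by
    have := congrArg (fun z => ⟪t, z⟫) hr
    simp only [inner_sub_right, h2, inner_smul_right, real_inner_self_eq_norm_sq, ht] at this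
    linarith
  rw [h3] at hr
  rw [sub_eq_iff_eq_add.1 hr]
  module

/-- As `h` is a multiple of `t`, the pseudoinverse annihilates it and all `hh'` terms disappear. The
remaining scalar equals `lam` because `τ = φ‖θ‖²`. -/
theorem psiPCA_eq {S : Matrix (Fin p) (Fin p) ℝ} {α₁ : ℝ} {μ₁ μ₂ : EuclideanSpace ℝ (Fin p)}
    {lam φ : ℝ} (hμ : μ₁ ≠ μ₂) (hS : S.PosDef)
    (hlam : lam = φ * (1 + beta α₁ * tau μ₁ μ₂ S)) (hφ : μ₂ - μ₁ = φ • theta μ₁ μ₂ S)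
    (hN : Matrix.toEuclideanLin (pinv (matM α₁ μ₁ μ₂ S lam)) (thetaDir μ₁ μ₂ S) = 0) :
    psiPCA α₁ μ₁ μ₂ S lam
      = lam • (pinv (matM α₁ μ₁ μ₂ S lam) * S * pinv (matM α₁ μ₁ μ₂ S lam)) := by
  have hθ : ‖theta μ₁ μ₂ S‖ ≠ 0 := norm_ne_zero_iff.2 (theta_ne_zero hμ hS)
  have hNh : pinv (matM α₁ μ₁ μ₂ S lam) *ᵥ (μ₂ - μ₁).ofLp = 0 := by
    have h1 : μ₂ - μ₁ = (φ * ‖theta μ₁ μ₂ S‖) • thetaDir μ₁ μ₂ S := by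
      rw [thetaDir, smul_smul, mul_assoc, mul_inv_cancel₀ hθ, mul_one, hφ]
    rw [← ofLp_toEuclideanLin_eq_mulVec, h1, map_smul, hN, smul_zero]
    rfl
  have hNH : pinv (matM α₁ μ₁ μ₂ S lam) * hhT μ₁ μ₂ = 0 := by
    rw [hhT, Matrix.mul_vecMulVec, hNh, Matrix.zero_vecMulVec]
  have htau : tau μ₁ μ₂ S = φ * ‖theta μ₁ μ₂ S‖ ^ 2 := by
    rw [tau_eq_inner, hφ, inner_smul_right, real_inner_self_eq_norm_sq]
  rw [psiPCA]
  simp only [Matrix.mul_add, Matrix.mul_smul, Matrix.mul_sub, hNH, smul_zero, sub_zero, add_zero,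
    Matrix.smul_mul, smul_smul]
  congr 1
  rw [hlam, htau]
  field_simp

end LimitCovariance

/-! ### Averages of independent copies -/

section Averages

variable {Ω E : Type*} [MeasurableSpace Ω] [MeasurableSpace E] {P : Measure Ω}
  {ν : Measure E} {X : ℕ → Ω → E} {f : E → ℝ}

theorem identDistrib_comp_of_hasLaw (hlaw : ∀ i, HasLaw (X i) ν P) (hf : Measurable f) (i : ℕ) :
    IdentDistrib (fun ω => f (X i ω)) (fun ω => f (X 0 ω)) P P :=
  (IdentDistrib.mk (hlaw i).aemeasurable (hlaw 0).aemeasurable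
    ((hlaw i).map_eq.trans (hlaw 0).map_eq.symm)).comp hf

theorem memLp_comp_of_hasLaw (hlaw : ∀ i, HasLaw (X i) ν P) (hf : Measurable f) {q : ENNReal}
    (hL : MemLp f q ν) (i : ℕ) : MemLp (fun ω => f (X i ω)) q P := by
  rw [← (hlaw i).map_eq] at hL
  exact (memLp_map_measure_iff hf.aestronglyMeasurable (hlaw i).aemeasurable).1 hL

theorem integral_comp_of_hasLaw (hlaw : ∀ i, HasLaw (X i) ν P) (hf : Measurable f) (i : ℕ) :
    ∫ ω, f (X i ω) ∂P = ∫ x, f x ∂ν := by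
  rw [← (hlaw i).map_eq, integral_map (hlaw i).aemeasurable hf.aestronglyMeasurable]

/-- Strong law of large numbers for a function of independent copies. -/
theorem ae_tendsto_average [IsProbabilityMeasure P] (hindep : iIndepFun X P) (hlaw : ∀ i, HasLaw (X i) ν P)
    (hf : Measurable f) (hint : Integrable f ν) :
    ∀ᵐ ω ∂P, Tendsto (fun n : ℕ => (n : ℝ)⁻¹ * ∑ i ∈ Finset.range n, f (X i ω)) atTop
      (𝓝 (∫ x, f x ∂ν)) := by
  have h := strong_law_ae (fun i ω => f (X i ω))
    (memLp_one_iff_integrable.1 (memLp_comp_of_hasLaw hlaw hf (memLp_one_iff_integrable.2 hint) 0))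
    (fun i j hij => (hindep.indepFun hij).comp hf hf)
    (identDistrib_comp_of_hasLaw hlaw hf)
  simpa [integral_comp_of_hasLaw hlaw hf] using h

theorem memLp_two_average_sub [IsProbabilityMeasure P] (hlaw : ∀ i, HasLaw (X i) ν P)
    (hf : Measurable f) (hL : MemLp f 2 ν) (c : ℝ) (n : ℕ) :
    MemLp (fun ω => (n : ℝ)⁻¹ * ∑ i ∈ Finset.range n, f (X i ω) - c) 2 P :=
  ((memLp_finsetSum _ fun i _ => memLp_comp_of_hasLaw hlaw hf hL i).const_mul _).sub
    (memLp_const c)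

/-- Mean square error of an average of independent copies. -/
theorem integral_sq_average_sub [IsProbabilityMeasure P] (hindep : iIndepFun X P) (hlaw : ∀ i, HasLaw (X i) ν P)
    (hf : Measurable f) (hL : MemLp f 2 ν) {n : ℕ} (hn : n ≠ 0) :
    ∫ ω, ((n : ℝ)⁻¹ * ∑ i ∈ Finset.range n, f (X i ω) - ∫ x, f x ∂ν) ^ 2 ∂P
      = Var[fun ω => f (X 0 ω); P] / n := by
  have hn' : (n : ℝ) ≠ 0 := Nat.cast_ne_zero.2 hn
  have hLi := memLp_comp_of_hasLaw hlaw hf hL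
  have hsum : MemLp (∑ i ∈ Finset.range n, fun ω => f (X i ω)) 2 P :=
    memLp_finsetSum' _ fun i _ => hLi i
  have hmean : ∫ ω, (n : ℝ)⁻¹ * (∑ i ∈ Finset.range n, fun ω => f (X i ω)) ω ∂P
      = ∫ x, f x ∂ν := by
    rw [integral_const_mul]
    simp only [Finset.sum_apply]
    rw [integral_finsetSum _ fun i _ => (hLi i).integrable (by norm_num)]
    simp [integral_comp_of_hasLaw hlaw hf, hn']
  have hvar := variance_eq_integral (μ := P) (hsum.const_mul (n : ℝ)⁻¹).aestronglyMeasurable.aemeasurable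
  rw [hmean, variance_const_mul, IndepFun.variance_sum (fun i _ => hLi i)
    (fun i _ j _ hij => (hindep.indepFun hij).comp hf hf)] at hvar
  simp only [Finset.sum_apply] at hvar
  rw [← hvar]
  simp only [fun i => (identDistrib_comp_of_hasLaw hlaw hf i).variance_eq, Finset.sum_const,
    Finset.card_range, nsmul_eq_mul]
  field_simp

/-- Central limit theorem for a centred function of independent copies, in terms of
characteristic functions. -/
theorem tendsto_charFun_normalized_sum [IsProbabilityMeasure P] (hindep : iIndepFun X P) (hlaw : ∀ i, HasLaw (X i) ν P)
    (hf : Measurable f) (hL : MemLp f 2 ν) (h0 : ∫ x, f x ∂ν = 0) :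
    Tendsto (fun n : ℕ => charFun
        (P.map fun ω => (Real.sqrt n)⁻¹ * ∑ i ∈ Finset.range n, f (X i ω)) 1) atTop
      (𝓝 (Complex.exp (-((∫ x, f x ^ 2 ∂ν : ℝ) : ℂ) / 2))) := by
  have hL0 := memLp_comp_of_hasLaw hlaw hf hL 0
  have hm : ∫ ω, f (X 0 ω) ∂P = 0 := by rw [integral_comp_of_hasLaw hlaw hf, h0]
  have hv : Var[fun ω => f (X 0 ω); P] = ∫ x, f x ^ 2 ∂ν := by
    rw [variance_of_integral_eq_zero hL0.aestronglyMeasurable.aemeasurable hm]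
    exact integral_comp_of_hasLaw hlaw (f := fun x => f x ^ 2) (by fun_prop) 0
  have hclt := tendstoInDistribution_inv_sqrt_mul_sum_sub (P := P)
    (X := fun i ω => f (X i ω)) (Y := id)
    (P' := gaussianReal 0 Var[fun ω => f (X 0 ω); P].toNNReal) HasLaw.id hL0
    (hindep.comp (fun _ => f) fun _ => hf) (identDistrib_comp_of_hasLaw hlaw hf)
  have h1 := (ProbabilityMeasure.tendsto_iff_tendsto_charFun.1 hclt.tendsto) 1
  simp only [ProbabilityMeasure.coe_mk, Measure.map_id, charFun_gaussianReal, hm, mul_zero,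
    sub_zero, hv] at h1
  have hnn : 0 ≤ ∫ x, f x ^ 2 ∂ν := integral_nonneg fun x => sq_nonneg _
  simpa [Real.coe_toNNReal _ hnn, neg_div] using h1

/-- The sum of the squared errors of the averages of finitely many functions. -/
noncomputable def sqErr {ι : Type*} [Fintype ι] (ν : Measure E) (f : ι → E → ℝ) (x : ℕ → E)
    (n : ℕ) : ℝ :=
  ∑ j, ((n : ℝ)⁻¹ * ∑ i ∈ Finset.range n, f j (x i) - ∫ y, f j y ∂ν) ^ 2

variable {ι : Type*} [Fintype ι] {F : ι → E → ℝ}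

theorem sqErr_nonneg (ν : Measure E) (F : ι → E → ℝ) (x : ℕ → E) (n : ℕ) :
    0 ≤ sqErr ν F x n :=
  Finset.sum_nonneg fun _ _ => sq_nonneg _

theorem ae_tendsto_sqErr [IsProbabilityMeasure P] (hindep : iIndepFun X P)
    (hlaw : ∀ i, HasLaw (X i) ν P) (hF : ∀ j, Measurable (F j)) (hint : ∀ j, Integrable (F j) ν) :
    ∀ᵐ ω ∂P, Tendsto (fun n => sqErr ν F (fun i => X i ω) n) atTop (𝓝 0) := by
  filter_upwards [ae_all_iff.2 fun j => ae_tendsto_average hindep hlaw (hF j) (hint j)] with ω hω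
  have h : Tendsto (fun n => sqErr ν F (fun i => X i ω) n) atTop (𝓝 (∑ _j : ι, (0 : ℝ))) := by
    refine tendsto_finsetSum _ fun j _ => ?_
    simpa using ((hω j).sub_const (∫ y, F j y ∂ν)).pow 2
  simpa using h

theorem integrable_sqErr [IsProbabilityMeasure P]
    (hlaw : ∀ i, HasLaw (X i) ν P) (hF : ∀ j, Measurable (F j)) (hL : ∀ j, MemLp (F j) 2 ν)
    (n : ℕ) : Integrable (fun ω => sqErr ν F (fun i => X i ω) n) P :=
  integrable_finsetSum _ fun j _ => (memLp_two_average_sub hlaw (hF j) (hL j) _ n).integrable_sq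

/-- The constant is the sum of the variances. This `1/n` rate is what defeats the factor `√n` in
front of the remainder. -/
theorem exists_integral_sqErr_eq_div [IsProbabilityMeasure P] (hindep : iIndepFun X P)
    (hlaw : ∀ i, HasLaw (X i) ν P) (hF : ∀ j, Measurable (F j)) (hL : ∀ j, MemLp (F j) 2 ν) :
    ∃ K : ℝ, ∀ n : ℕ, n ≠ 0 → ∫ ω, sqErr ν F (fun i => X i ω) n ∂P = K / n := by
  refine ⟨∑ j, Var[fun ω => F j (X 0 ω); P], fun n hn => ?_⟩
  simp only [sqErr]
  rw [integral_finsetSum _ fun j _ =>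
    (memLp_two_average_sub hlaw (hF j) (hL j) _ n).integrable_sq, Finset.sum_div]
  exact Finset.sum_congr rfl fun j _ => integral_sq_average_sub hindep hlaw (hF j) (hL j) hn

end Averages

/-! ### Scatter around the true mean -/

section Scatter

open scoped RealInnerProductSpace

variable {p : ℕ}

/-- The average of `(x i - m) (x i - m)'` over the first `n` data points. -/
noncomputable def scatter (m : EuclideanSpace ℝ (Fin p)) (x : ℕ → EuclideanSpace ℝ (Fin p))
    (n : ℕ) : Matrix (Fin p) (Fin p) ℝ :=
  (n : ℝ)⁻¹ • ∑ i ∈ Finset.range n, Matrix.vecMulVec (x i - m).ofLp (x i - m).ofLp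

theorem sampleMean_sub (m : EuclideanSpace ℝ (Fin p)) (x : ℕ → EuclideanSpace ℝ (Fin p))
    {n : ℕ} (hn : n ≠ 0) :
    sampleMean x n - m = (n : ℝ)⁻¹ • ∑ i ∈ Finset.range n, (x i - m) := by
  have hn' : (n : ℝ) ≠ 0 := Nat.cast_ne_zero.2 hn
  rw [sampleMean, Finset.sum_sub_distrib, Finset.sum_const, Finset.card_range, smul_sub,
    ← Nat.cast_smul_eq_nsmul ℝ, smul_smul, inv_mul_cancel₀ hn', one_smul]

/-- Centring at a fixed `m` makes the summands independent. The price is a rank-one term quadratic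
in the error of the mean, too small to affect the limit. -/
theorem sampleCov_eq_scatter_sub (m : EuclideanSpace ℝ (Fin p))
    (x : ℕ → EuclideanSpace ℝ (Fin p)) {n : ℕ} (hn : n ≠ 0) :
    sampleCov x n = scatter m x n
      - Matrix.vecMulVec (sampleMean x n - m).ofLp (sampleMean x n - m).ofLp := by
  have hn' : (n : ℝ) ≠ 0 := Nat.cast_ne_zero.2 hn
  ext j k
  have e : ∀ j, ∑ i ∈ Finset.range n, (x i j - m j) = n * (sampleMean x n j - m j) := by
    intro j
    have := congrArg (fun z : EuclideanSpace ℝ (Fin p) => z j) (sampleMean_sub m x hn)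
    simp at this
    rw [this]
    simp [hn']
  simp only [sampleCov, scatter, Matrix.sub_apply, Matrix.smul_apply, Matrix.sum_apply,
    Matrix.vecMulVec_apply, PiLp.sub_apply, smul_eq_mul]
  have : ∀ i, (x i j - sampleMean x n j) * (x i k - sampleMean x n k)
      = (x i j - m j) * (x i k - m k) - (sampleMean x n k - m k) * (x i j - m j)
        - (sampleMean x n j - m j) * (x i k - m k)
        + (sampleMean x n j - m j) * (sampleMean x n k - m k) := fun i => by ring
  simp only [this, Finset.sum_add_distrib, Finset.sum_sub_distrib, ← Finset.mul_sum, e,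
    Finset.sum_const, Finset.card_range, nsmul_eq_mul]
  field_simp
  ring

theorem sampleCov_isHermitian (x : ℕ → EuclideanSpace ℝ (Fin p)) (n : ℕ) :
    (sampleCov x n).IsHermitian := by
  ext j k
  simp [sampleCov, Matrix.sum_apply, Matrix.vecMulVec_apply, mul_comm]

theorem toEuclideanLin_vecMulVec_apply (e v : EuclideanSpace ℝ (Fin p)) :
    Matrix.toEuclideanLin (Matrix.vecMulVec e.ofLp e.ofLp) v = ⟪v, e⟫ • e := by
  simpa [hhT] using toEuclideanLin_hhT_apply 0 e v

theorem toEuclideanLin_scatter_apply (m t : EuclideanSpace ℝ (Fin p))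
    (x : ℕ → EuclideanSpace ℝ (Fin p)) (n : ℕ) :
    Matrix.toEuclideanLin (scatter m x n) t
      = (n : ℝ)⁻¹ • ∑ i ∈ Finset.range n, ⟪t, x i - m⟫ • (x i - m) := by
  rw [scatter, map_smul, map_sum, LinearMap.smul_apply, LinearMap.sum_apply]
  simp only [toEuclideanLin_vecMulVec_apply]

theorem inner_toEuclideanLin_scatter (m b t : EuclideanSpace ℝ (Fin p))
    (x : ℕ → EuclideanSpace ℝ (Fin p)) (n : ℕ) :
    ⟪b, Matrix.toEuclideanLin (scatter m x n) t⟫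
      = (n : ℝ)⁻¹ * ∑ i ∈ Finset.range n, ⟪b, x i - m⟫ * ⟪t, x i - m⟫ := by
  rw [toEuclideanLin_scatter_apply, inner_smul_right, inner_sum]
  congr 1
  refine Finset.sum_congr rfl fun i _ => ?_
  rw [inner_smul_right, mul_comm]

theorem scatter_apply (m : EuclideanSpace ℝ (Fin p)) (x : ℕ → EuclideanSpace ℝ (Fin p)) (n : ℕ)
    (j k : Fin p) :
    scatter m x n j k = (n : ℝ)⁻¹ * ∑ i ∈ Finset.range n, (x i - m) j * (x i - m) k := by
  simp [scatter, Matrix.sum_apply, Matrix.vecMulVec_apply]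

/-- Cauchy-Schwarz in each row. The Frobenius norm is convenient because its square is a sum of
squared errors of averages, whose expectation is explicit. -/
theorem norm_toEuclideanLin_le (A : Matrix (Fin p) (Fin p) ℝ) (v : EuclideanSpace ℝ (Fin p)) :
    ‖Matrix.toEuclideanLin A v‖ ≤ Real.sqrt (∑ j, ∑ k, A j k ^ 2) * ‖v‖ := by
  refine abs_le_of_sq_le_sq' ?_ (by positivity) |>.2
  rw [mul_pow, Real.sq_sqrt (by positivity), EuclideanSpace.real_norm_sq_eq,
    EuclideanSpace.real_norm_sq_eq, Finset.sum_mul]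
  refine Finset.sum_le_sum fun j _ => ?_
  have h := Finset.sum_mul_sq_le_sq_mul_sq Finset.univ (A j) v.ofLp
  exact h

theorem norm_toEuclideanLin_vecMulVec_le (e v : EuclideanSpace ℝ (Fin p)) :
    ‖Matrix.toEuclideanLin (Matrix.vecMulVec e.ofLp e.ofLp) v‖ ≤ ‖e‖ ^ 2 * ‖v‖ := by
  rw [toEuclideanLin_vecMulVec_apply, norm_smul]
  calc _ ≤ ‖v‖ * ‖e‖ * ‖e‖ := by gcongr; exact norm_inner_le_norm v e
    _ = _ := by ring

end Scatter

/-! ### Expansion of the sample eigenvector -/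

section Expansion

open scoped RealInnerProductSpace

variable {p : ℕ}

/-- Use the linear bound if `s ≤ y` and the quadratic one otherwise. With `y` the squared error of
the mean, the quadratic bound alone would produce `y²`; here only `y` and `s²` remain, both of mean
`O(1/n)`. -/
theorem le_of_le_mul_add_of_le_mul_sq_add {a b s y L : ℝ} (ha : 0 ≤ a) (hb : 0 ≤ b) (hs : 0 ≤ s)
    (hy : 0 ≤ y) (h1 : L ≤ a * (s + y)) (h2 : L ≤ b * (s + y) ^ 2) :
    L ≤ 2 * a * y + 4 * b * s ^ 2 := by
  rcases le_total s y with h | h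
  · have h3 : a * (s + y) ≤ a * (2 * y) := by gcongr; linarith
    have h4 : 0 ≤ 4 * b * s ^ 2 := by positivity
    linarith
  · have h3 : b * (s + y) ^ 2 ≤ b * (2 * s) ^ 2 := by gcongr; linarith
    have h4 : 0 ≤ 2 * a * y := by positivity
    linarith

/-- Expansion of a leading eigenvector of the sample covariance matrix around the leading
eigenvector `t` of a symmetric matrix `A` with a simple largest eigenvalue. -/
theorem exists_leading_eigenvector_expansion {A : Matrix (Fin p) (Fin p) ℝ} (hA : A.IsHermitian)
    {t : EuclideanSpace ℝ (Fin p)} {lam : ℝ} (ht : ‖t‖ = 1)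
    (hAt : Matrix.toEuclideanLin A t = lam • t)
    (hmax : ∀ a : ℝ, Module.End.HasEigenvalue (Matrix.toEuclideanLin A) a → a ≤ lam)
    (hsimple : ∀ v, Matrix.toEuclideanLin A v = lam • v → ∃ r : ℝ, v = r • t) :
    ∃ K : ℝ, ∀ (m : EuclideanSpace ℝ (Fin p)) (x : ℕ → EuclideanSpace ℝ (Fin p)) (n : ℕ)
      (v : EuclideanSpace ℝ (Fin p)), n ≠ 0 → IsLeadingUnitEigenvector (sampleCov x n) v →
      0 ≤ ⟪t, v⟫ →
      ‖v - t‖ ≤ K * (Real.sqrt (∑ j, ∑ k, (scatter m x n - A) j k ^ 2) + ‖sampleMean x n - m‖ ^ 2) ∧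
      ‖v - t + Matrix.toEuclideanLin (pinv (A - lam • (1 : Matrix (Fin p) (Fin p) ℝ)))
          (Matrix.toEuclideanLin (scatter m x n) t)‖
        ≤ K * (∑ j, ∑ k, (scatter m x n - A) j k ^ 2 + ‖sampleMean x n - m‖ ^ 2) := by
  have hsymm := Matrix.isSymmetric_toEuclideanLin_iff.2 hA
  obtain ⟨g, hg, hgap⟩ := exists_spectral_gap hsymm hmax hsimple
  obtain ⟨hNt, -, hN⟩ := pinv_apply_sub_smul hA ht hAt hsimple
  set B := pinv (A - lam • (1 : Matrix (Fin p) (Fin p) ℝ)) with hB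
  set N := Matrix.toEuclideanLin B
  set κ := Real.sqrt (∑ j, ∑ k, B j k ^ 2) with hκ
  have hκ0 : 0 ≤ κ := Real.sqrt_nonneg _
  have hNκ : ∀ y, ‖N y‖ ≤ κ * ‖y‖ := norm_toEuclideanLin_le B
  -- The constant adds the coefficients of `y` and `q` in `h4` to that of the rank-one correction in
  -- `h3`. It also exceeds `4 / g`, as the first bound requires.
  refine ⟨2 * (4 / g + κ) + κ + 4 * (6 * κ / g + 4 / g ^ 2), fun m x n v hn hv hpos => ?_⟩
  obtain ⟨hv1, ℓ, hℓ, hℓmax⟩ := hv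
  set q := ∑ j, ∑ k, (scatter m x n - A) j k ^ 2 with hq
  set e := sampleMean x n - m with he
  have hq0 : 0 ≤ q := by positivity
  have hdecomp : ∀ y, Matrix.toEuclideanLin (sampleCov x n) y - Matrix.toEuclideanLin A y
      = Matrix.toEuclideanLin (scatter m x n - A) y
        - Matrix.toEuclideanLin (Matrix.vecMulVec e.ofLp e.ofLp) y := by
    intro y
    rw [sampleCov_eq_scatter_sub m x hn, ← he]
    simp only [map_sub, LinearMap.sub_apply]
    abel
  have hδ : ∀ y, ‖Matrix.toEuclideanLin (sampleCov x n) y - Matrix.toEuclideanLin A y‖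
      ≤ (Real.sqrt q + ‖e‖ ^ 2) * ‖y‖ := by
    intro y
    rw [hdecomp, add_mul]
    exact (norm_sub_le _ _).trans
      (add_le_add (norm_toEuclideanLin_le _ y) (norm_toEuclideanLin_vecMulVec_le e y))
  have hray := inner_apply_le_of_eigenvalue_le
    (Matrix.isSymmetric_toEuclideanLin_iff.2 (sampleCov_isHermitian x n)) hℓmax
  have hCv := Module.End.mem_eigenspace_iff.1 hℓ.1
  obtain ⟨hw, -⟩ := norm_orthogonal_component_le hsymm ht hAt hg hgap hδ hv1 hCv hray
  obtain ⟨h1, h2⟩ := norm_sub_add_le hsymm ht hAt hg hgap hN hNt hNκ hδ hv1 hpos hCv hray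
  have hs : Real.sqrt q ^ 2 = q := Real.sq_sqrt hq0
  have hs0 := Real.sqrt_nonneg q
  set s := Real.sqrt q
  set y := ‖e‖ ^ 2 with hy
  have hy0 : 0 ≤ y := sq_nonneg _
  have hc1 : 0 ≤ 4 / g := by positivity
  have hc2 : 0 ≤ 6 * κ / g + 4 / g ^ 2 := by positivity
  constructor
  · calc _ ≤ 2 * _ := (norm_sub_le_two_mul ht hv1 hpos).2
      _ ≤ 2 * (2 * (s + y) / g) := by gcongr
      _ = 4 / g * (s + y) := by ring
      _ ≤ _ := by
        gcongr
        linarith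
  -- Since `N (A t) = lam • N t = 0`, the matrix `A` may be subtracted freely.
  · have hNA : N (Matrix.toEuclideanLin (scatter m x n) t)
        = N (Matrix.toEuclideanLin (sampleCov x n) t - Matrix.toEuclideanLin A t)
          + N (Matrix.toEuclideanLin (Matrix.vecMulVec e.ofLp e.ofLp) t) := by
      rw [hdecomp, map_sub Matrix.toEuclideanLin, LinearMap.sub_apply, hAt]
      simp only [map_sub, map_smul, hNt]
      simp
    have h3 : ‖N (Matrix.toEuclideanLin (Matrix.vecMulVec e.ofLp e.ofLp) t)‖ ≤ κ * y := by
      refine (hNκ _).trans ?_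
      gcongr
      simpa [ht] using norm_toEuclideanLin_vecMulVec_le e t
    have h4 : ‖v - t + N (Matrix.toEuclideanLin (sampleCov x n) t - Matrix.toEuclideanLin A t)‖
        ≤ 2 * (4 / g + κ) * y + 4 * (6 * κ / g + 4 / g ^ 2) * q := by
      rw [← hs]
      exact le_of_le_mul_add_of_le_mul_sq_add (by positivity) hc2 hs0 hy0 h1 h2
    rw [hNA, ← add_assoc]
    refine (norm_add_le _ _).trans ((add_le_add h4 h3).trans ?_)
    have a1 : 0 ≤ (4 / g + κ) * q := by positivity
    have a2 : 0 ≤ κ * q := by positivity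
    have a3 : 0 ≤ (6 * κ / g + 4 / g ^ 2) * y := by positivity
    linarith

/-- The coordinates of a centred vector. -/
def centredCoord (m : EuclideanSpace ℝ (Fin p)) (j : Fin p) (x : EuclideanSpace ℝ (Fin p)) : ℝ :=
  (x - m) j

/-- The products of two coordinates of a centred vector. -/
def centredProd (m : EuclideanSpace ℝ (Fin p)) (jk : Fin p × Fin p)
    (x : EuclideanSpace ℝ (Fin p)) : ℝ :=
  (x - m) jk.1 * (x - m) jk.2

theorem measurable_centredCoord (m : EuclideanSpace ℝ (Fin p)) (j : Fin p) :
    Measurable (centredCoord m j) := by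
  unfold centredCoord
  fun_prop

theorem measurable_centredProd (m : EuclideanSpace ℝ (Fin p)) (jk : Fin p × Fin p) :
    Measurable (centredProd m jk) := by
  unfold centredProd
  fun_prop

theorem sqErr_centredCoord {ν : Measure (EuclideanSpace ℝ (Fin p))}
    {m : EuclideanSpace ℝ (Fin p)} (h0 : ∀ j, ∫ x, centredCoord m j x ∂ν = 0)
    (x : ℕ → EuclideanSpace ℝ (Fin p)) {n : ℕ} (hn : n ≠ 0) :
    sqErr ν (centredCoord m) x n = ‖sampleMean x n - m‖ ^ 2 := by
  rw [sampleMean_sub m x hn, EuclideanSpace.real_norm_sq_eq, sqErr]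
  simp only [h0, sub_zero]
  simp [centredCoord]

theorem sqErr_centredProd {ν : Measure (EuclideanSpace ℝ (Fin p))}
    {m : EuclideanSpace ℝ (Fin p)} {A : Matrix (Fin p) (Fin p) ℝ}
    (hA : ∀ jk : Fin p × Fin p, ∫ x, centredProd m jk x ∂ν = A jk.1 jk.2)
    (x : ℕ → EuclideanSpace ℝ (Fin p)) (n : ℕ) :
    sqErr ν (centredProd m) x n = ∑ j, ∑ k, (scatter m x n - A) j k ^ 2 := by
  rw [sqErr, Fintype.sum_prod_type]
  simp only [hA, Matrix.sub_apply, scatter_apply]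
  rfl

end Expansion

/-! ### Central limit theorem for the linear term -/

section LinearTerm

open scoped RealInnerProductSpace

variable {p : ℕ} {Ω : Type*} [MeasurableSpace Ω] {P : Measure Ω} [IsProbabilityMeasure P]
  {ν : Measure (EuclideanSpace ℝ (Fin p))} {X : ℕ → Ω → EuclideanSpace ℝ (Fin p)}

/-- Asymptotic normality of a linear function of the scatter matrix applied to a vector. -/
theorem tendstoInDistribution_scatter (hindep : iIndepFun X P) (hlaw : ∀ i, HasLaw (X i) ν P)
    {B Ψ : Matrix (Fin p) (Fin p) ℝ} {m t : EuclideanSpace ℝ (Fin p)}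
    (hB : (Matrix.toEuclideanLin B).IsSymmetric) (hΨ : Ψ.PosSemidef)
    (hL : ∀ b, MemLp (fun x => ⟪b, x - m⟫ * ⟪t, x - m⟫) 2 ν)
    (h0 : ∀ a, ∫ x, ⟪Matrix.toEuclideanLin B a, x - m⟫ * ⟪t, x - m⟫ ∂ν = 0)
    (hvar : ∀ a : EuclideanSpace ℝ (Fin p),
      ∫ x, (⟪Matrix.toEuclideanLin B a, x - m⟫ * ⟪t, x - m⟫) ^ 2 ∂ν = a.ofLp ⬝ᵥ Ψ *ᵥ a.ofLp) :
    TendstoInDistribution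
      (fun (n : ℕ) ω => -(Real.sqrt n • Matrix.toEuclideanLin B
        (Matrix.toEuclideanLin (scatter m (fun i => X i ω) n) t))) atTop id
      (fun _ => P) (multivariateGaussian 0 Ψ) := by
  have hmeas : ∀ n : ℕ, AEMeasurable (fun ω => -(Real.sqrt n • Matrix.toEuclideanLin B
      (Matrix.toEuclideanLin (scatter m (fun i => X i ω) n) t))) P := by
    intro n
    have hX := fun i => (hlaw i).aemeasurable
    have hBm : Measurable (Matrix.toEuclideanLin B) :=
      (LinearMap.continuous_of_finiteDimensional _).measurable
    simp only [toEuclideanLin_scatter_apply]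
    suffices h : AEMeasurable (fun ω => ∑ i ∈ Finset.range n, ⟪t, X i ω - m⟫ • (X i ω - m)) P from
      ((hBm.comp_aemeasurable (h.const_smul (n : ℝ)⁻¹)).const_smul (Real.sqrt n)).neg
    refine Finset.aemeasurable_fun_sum _ fun i _ => ?_
    have hf : Measurable fun x : EuclideanSpace ℝ (Fin p) => ⟪t, x - m⟫ • (x - m) := by fun_prop
    exact hf.comp_aemeasurable (hX i)
  refine ⟨hmeas, aemeasurable_id, ProbabilityMeasure.tendsto_iff_tendsto_charFun.2 fun a => ?_⟩
  simp only [ProbabilityMeasure.coe_mk, Measure.map_id]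
  rw [charFun_multivariateGaussian hΨ]
  have h := tendsto_charFun_normalized_sum hindep hlaw
    (f := fun x => ⟪-Matrix.toEuclideanLin B a, x - m⟫ * ⟪t, x - m⟫) (by fun_prop) (hL _)
    (by simpa [inner_neg_left, integral_neg] using h0 a)
  simp only [inner_neg_left, neg_mul, neg_sq, hvar] at h
  -- Cramér-Wold: the characteristic function at `a` is that of the pairing with `a`, taken at `1`.
  -- The symmetry of `B` moves it onto `a`, and `√n / n = (√n)⁻¹` holds also for `n = 0`.
  have e1 : ∀ n : ℕ, charFun (P.map fun ω => -(Real.sqrt n • Matrix.toEuclideanLin B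
        (Matrix.toEuclideanLin (scatter m (fun i => X i ω) n) t))) a
      = charFun (P.map fun ω => (Real.sqrt n)⁻¹ * ∑ i ∈ Finset.range n,
        -(⟪Matrix.toEuclideanLin B a, X i ω - m⟫ * ⟪t, X i ω - m⟫)) 1 := by
    intro n
    have e2 : ∀ ω, (Real.sqrt n)⁻¹ * ∑ i ∈ Finset.range n,
        -(⟪Matrix.toEuclideanLin B a, X i ω - m⟫ * ⟪t, X i ω - m⟫)
        = ⟪-(Real.sqrt n • Matrix.toEuclideanLin B
          (Matrix.toEuclideanLin (scatter m (fun i => X i ω) n) t)), a⟫ := by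
      intro ω
      rw [inner_neg_left, inner_smul_left, hB, real_inner_comm, inner_toEuclideanLin_scatter,
        Finset.sum_neg_distrib, mul_neg, ← mul_assoc]
      congr 2
      simp only [RCLike.conj_to_real]
      rw [← div_eq_mul_inv, Real.sqrt_div_self]
    simp only [e2]
    rw [charFun_apply, charFun_apply, integral_map (hmeas n) (by fun_prop),
      integral_map ((hmeas n).inner_const) (by fun_prop)]
    simp
  simp only [e1]
  simpa [neg_div] using h

end LinearTerm

/-! ### Choice of the signs -/

section Signs

open scoped RealInnerProductSpace

variable {p : ℕ} {Ω : Type*} [MeasurableSpace Ω] {P : Measure Ω}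

theorem IsLeadingUnitEigenvector.neg {A : Matrix (Fin p) (Fin p) ℝ}
    {v : EuclideanSpace ℝ (Fin p)} (h : IsLeadingUnitEigenvector A v) :
    IsLeadingUnitEigenvector A (-v) := by
  obtain ⟨h1, ℓ, h2, h3⟩ := h
  refine ⟨by rw [norm_neg, h1], ℓ, ⟨Submodule.neg_mem _ h2.1, neg_ne_zero.2 h2.2⟩, h3⟩

/-- Measurable signs that turn a random vector into the half-space around `t`. -/
theorem exists_sign {u : Ω → EuclideanSpace ℝ (Fin p)} (hu : AEMeasurable u P)
    (t : EuclideanSpace ℝ (Fin p)) :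
    ∃ s : Ω → ℝ, Measurable s ∧ (∀ ω, s ω = -1 ∨ s ω = 1) ∧ ∀ᵐ ω ∂P, 0 ≤ ⟪t, s ω • u ω⟫ := by
  -- The sign is read off a measurable version of `u`, so that it is measurable and not merely
  -- almost everywhere measurable.
  refine ⟨fun ω => if 0 ≤ ⟪t, hu.mk u ω⟫ then 1 else -1, ?_, fun ω => ?_, ?_⟩
  · exact Measurable.ite (measurableSet_le measurable_const (hu.measurable_mk.const_inner))
      measurable_const measurable_const
  · by_cases h : 0 ≤ ⟪t, hu.mk u ω⟫ <;> simp [h]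
  · filter_upwards [hu.ae_eq_mk] with ω hω
    rw [hω]
    by_cases h : 0 ≤ ⟪t, hu.mk u ω⟫
    · simp [h]
    · simp only [h, if_false, inner_smul_right]
      linarith

end Signs

/-! ### Negligible remainders -/

section Remainder

variable {Ω F : Type*} [MeasurableSpace Ω] {P : Measure Ω} [NormedAddCommGroup F]
  [MeasurableSpace F] [BorelSpace F] [SecondCountableTopology F]

/-- A remainder bounded by `√n` times a nonnegative variable of mean `O(1/n)` vanishes in
probability. -/
theorem tendstoInMeasure_zero_of_norm_le_sqrt_mul {W : ℕ → Ω → F} {R : ℕ → Ω → ℝ} {K c : ℝ}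
    (hW : ∀ n, AEMeasurable (W n) P) (hR : ∀ n, Integrable (R n) P) (hR0 : ∀ n ω, 0 ≤ R n ω)
    (hint : ∀ n : ℕ, n ≠ 0 → ∫ ω, R n ω ∂P = c / n)
    (hle : ∀ n : ℕ, n ≠ 0 → ∀ᵐ ω ∂P, ‖W n ω‖ ≤ Real.sqrt n * (K * R n ω)) :
    TendstoInMeasure P W atTop 0 := by
  refine tendstoInMeasure_of_tendsto_eLpNorm one_ne_zero (fun n => (hW n).aestronglyMeasurable)
    aestronglyMeasurable_zero ?_
  -- The `L¹` norm is at most `√n · |K| · c / n`; the absolute value is there because `K` may be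
  -- negative.
  have hlim : Tendsto (fun n : ℕ => ENNReal.ofReal (|K| * c * (Real.sqrt n)⁻¹)) atTop (𝓝 0) := by
    rw [← ENNReal.ofReal_zero]
    refine (ENNReal.continuous_ofReal.tendsto 0).comp ?_
    rw [← mul_zero (|K| * c)]
    exact (tendsto_inv_atTop_zero.comp
      (Real.tendsto_sqrt_atTop.comp tendsto_natCast_atTop_atTop)).const_mul _
  refine tendsto_of_tendsto_of_tendsto_of_le_of_le' tendsto_const_nhds hlim
    (.of_forall fun n => zero_le) ?_
  filter_upwards [eventually_ne_atTop 0] with n hn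
  have hb : ∀ᵐ ω ∂P, ‖(W n - 0) ω‖ ≤ Real.sqrt n * |K| * R n ω := by
    filter_upwards [hle n hn] with ω hω
    rw [sub_zero, mul_assoc]
    refine hω.trans ?_
    gcongr
    · exact hR0 n ω
    · exact le_abs_self K
  refine (eLpNorm_mono_ae_real hb).trans ?_
  rw [eLpNorm_one_eq_lintegral_enorm, ← ofReal_integral_norm_eq_lintegral_enorm
    ((hR n).const_mul _)]
  refine ENNReal.ofReal_le_ofReal (le_of_eq ?_)
  have e : ∀ ω, ‖Real.sqrt n * |K| * R n ω‖ = Real.sqrt n * |K| * R n ω := fun ω =>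
    Real.norm_of_nonneg (mul_nonneg (by positivity) (hR0 n ω))
  simp only [e]
  rw [integral_const_mul, hint n hn, ← Real.sqrt_div_self]
  ring

end Remainder

/-! ### Coordinate moments of the mixture -/

section MixtureCoordinates

variable {p : ℕ} {α₁ : ℝ} {μ₁ μ₂ : EuclideanSpace ℝ (Fin p)} {S : Matrix (Fin p) (Fin p) ℝ}

theorem memLp_two_centredCoord_mixture (m : EuclideanSpace ℝ (Fin p)) (j : Fin p) :
    MemLp (centredCoord m j) 2 (mixture α₁ μ₁ μ₂ S) := by
  have h := memLp_two_inner_mixture (α₁ := α₁) (S := S) (μ₁ := μ₁) (μ₂ := μ₂)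
    (EuclideanSpace.single j 1) m
  simp only [inner_single_one] at h
  exact h

theorem memLp_two_centredProd_mixture (m : EuclideanSpace ℝ (Fin p)) (jk : Fin p × Fin p) :
    MemLp (centredProd m jk) 2 (mixture α₁ μ₁ μ₂ S) := by
  have h := memLp_two_inner_mul_inner_mixture (α₁ := α₁) (S := S) (μ₁ := μ₁) (μ₂ := μ₂)
    (EuclideanSpace.single jk.1 1) (EuclideanSpace.single jk.2 1) m
  simp only [inner_single_one] at h
  exact h

theorem integral_centredCoord_mixture (hα₀ : 0 ≤ α₁) (hα₁ : α₁ ≤ 1) (j : Fin p) :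
    ∫ x, centredCoord (∫ z, z ∂(mixture α₁ μ₁ μ₂ S)) j x ∂(mixture α₁ μ₁ μ₂ S) = 0 := by
  have := isProbabilityMeasure_mixture (S := S) (μ₁ := μ₁) (μ₂ := μ₂) hα₀ hα₁
  have hi : Integrable (fun x : EuclideanSpace ℝ (Fin p) => x) (mixture α₁ μ₁ μ₂ S) :=
    integrable_mixture IsGaussian.integrable_fun_id IsGaussian.integrable_fun_id
  have h0 : ∫ x, (x - ∫ z, z ∂(mixture α₁ μ₁ μ₂ S)) ∂(mixture α₁ μ₁ μ₂ S) = 0 := by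
    rw [integral_sub hi (integrable_const _)]
    simp
  have h1 := (EuclideanSpace.proj (𝕜 := ℝ) j).integral_comp_comm
    (hi.sub (integrable_const (∫ z, z ∂(mixture α₁ μ₁ μ₂ S))))
  simp only [Pi.sub_apply, h0, map_zero] at h1
  exact h1

theorem integral_centredProd_mixture (hα₀ : 0 ≤ α₁) (hα₁ : α₁ ≤ 1) (hS : S.PosSemidef)
    (jk : Fin p × Fin p) :
    ∫ x, centredProd (∫ z, z ∂(mixture α₁ μ₁ μ₂ S)) jk x ∂(mixture α₁ μ₁ μ₂ S)
      = covMatrix (mixture α₁ μ₁ μ₂ S) jk.1 jk.2 := by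
  have h := integral_inner_mul_inner_mixture (μ₁ := μ₁) (μ₂ := μ₂) hα₀ hα₁ hS
    (EuclideanSpace.single jk.1 1) (EuclideanSpace.single jk.2 1)
  rw [← covMatrix_mixture hα₀ hα₁ hS] at h
  simp only [inner_single_one, PiLp.ofLp_single, Matrix.mulVec_single_one,
    single_one_dotProduct] at h
  exact h

end MixtureCoordinates

end MixturePCA

/-! ### Consistency and asymptotic normality of the leading eigenvector -/

theorem mainTheorem5 {p : ℕ} {Ω : Type*} [MeasurableSpace Ω] (P : Measure Ω)
    [IsProbabilityMeasure P]
    (α₁ : ℝ) (hα₀ : 0 < α₁) (hα₁ : α₁ < 1)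
    (μ₁ μ₂ : EuclideanSpace ℝ (Fin p)) (hμ : μ₁ ≠ μ₂)
    (S : Matrix (Fin p) (Fin p) ℝ) (hS : S.PosDef)
    (hcond : EigenvalueCondition α₁ μ₁ μ₂ S ∨ UniqueLeadingCondition α₁ μ₁ μ₂ S)
    (X : ℕ → Ω → EuclideanSpace ℝ (Fin p))
    (hindep : iIndepFun X P) (hlaw : ∀ i, HasLaw (X i) (mixture α₁ μ₁ μ₂ S) P)
    (u : ℕ → Ω → EuclideanSpace ℝ (Fin p)) (hu : ∀ n, AEMeasurable (u n) P)
    (hlead : ∀ n, 1 ≤ n →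
      ∀ᵐ ω ∂P, IsLeadingUnitEigenvector (sampleCov (fun i => X i ω) n) (u n ω)) :
    ∃ s : ℕ → Ω → ℝ, (∀ n, Measurable (s n)) ∧ (∀ n ω, s n ω = -1 ∨ s n ω = 1) ∧
      (∀ᵐ ω ∂P, Tendsto (fun n => s n ω • u n ω) atTop (𝓝 (thetaDir μ₁ μ₂ S))) ∧
      ∃ lam : ℝ,
        Module.End.HasEigenvector
          (Matrix.toEuclideanLin (covMatrix (mixture α₁ μ₁ μ₂ S))) lam (thetaDir μ₁ μ₂ S) ∧
        (psiPCA α₁ μ₁ μ₂ S lam).PosSemidef ∧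
        TendstoInDistribution
          (fun (n : ℕ) ω => Real.sqrt n • (s n ω • u n ω - thetaDir μ₁ μ₂ S)) atTop id
          (fun _ => P) (multivariateGaussian 0 (psiPCA α₁ μ₁ μ₂ S lam)) := by
  have hSp := hS.posSemidef
  have hprob := isProbabilityMeasure_mixture (S := S) (μ₁ := μ₁) (μ₂ := μ₂) hα₀.le hα₁.le
  obtain ⟨φ, lam, hφ, hlam, hh, hAt, hmax, hsimple⟩ :=
    exists_leading_eigenvalue hα₀ hα₁ hμ hS hcond
  have ht := norm_thetaDir hμ hS
  have hA := covMatrix_isHermitian (mixture α₁ μ₁ μ₂ S)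
  obtain ⟨hNt, hNs, -⟩ := pinv_apply_sub_smul hA ht hAt hsimple
  obtain ⟨K, hK⟩ := exists_leading_eigenvector_expansion hA ht hAt hmax hsimple
  have hcov := covMatrix_mixture (μ₁ := μ₁) (μ₂ := μ₂) hα₀.le hα₁.le hSp
  have hM : covMatrix (mixture α₁ μ₁ μ₂ S) - lam • (1 : Matrix (Fin p) (Fin p) ℝ)
      = matM α₁ μ₁ μ₂ S lam := by rw [hcov, matM]
  rw [hM] at hNt hNs hK
  have hΨ := psiPCA_eq hμ hS hlam hh hNt
  set t := thetaDir μ₁ μ₂ S with ht_def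
  set B := pinv (matM α₁ μ₁ μ₂ S lam) with hB
  set ν := mixture α₁ μ₁ μ₂ S with hν
  set m := ∫ z, z ∂ν with hm
  have ht0 : t ≠ 0 := norm_ne_zero_iff.1 (by rw [ht]; exact one_ne_zero)
  have hlam0 : 0 < lam := by
    have := mul_pos (beta_pos hα₀ hα₁) (tau_pos hμ hS)
    rw [hlam]
    positivity
  have hBsymm : (Matrix.toEuclideanLin B).IsSymmetric := by
    rw [Matrix.isSymmetric_toEuclideanLin_iff, Matrix.IsHermitian,
      Matrix.conjTranspose_eq_transpose_of_trivial, hNs]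
  have hpsd : (psiPCA α₁ μ₁ μ₂ S lam).PosSemidef := by
    rw [hΨ]
    refine Matrix.PosSemidef.smul ?_ hlam0.le
    have := hSp.mul_mul_conjTranspose_same B
    rwa [Matrix.conjTranspose_eq_transpose_of_trivial, hNs] at this
  -- the directions `B a` are orthogonal to `t`
  have hBa : ∀ a, inner ℝ (Matrix.toEuclideanLin B a) t = 0 := fun a => by
    rw [hBsymm, hNt, inner_zero_right]
  have hθt : theta μ₁ μ₂ S = ‖theta μ₁ μ₂ S‖ • t := by
    rw [ht_def, thetaDir, smul_smul,
      mul_inv_cancel₀ (norm_ne_zero_iff.2 (theta_ne_zero hμ hS)), one_smul]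
  have hBh : ∀ a, inner ℝ (Matrix.toEuclideanLin B a) (μ₂ - μ₁) = 0 := fun a => by
    rw [hh, hθt, inner_smul_right, inner_smul_right, hBa, mul_zero, mul_zero]
  have hSt : Matrix.toEuclideanLin S t = φ • t := by
    rw [ht_def, thetaDir, map_smul, toEuclideanLin_theta hS, hh, smul_comm]
  -- The summands are centred because the covariance matrix maps `t` to `lam • t`, orthogonal to `B
  -- a`. Their second moment is `lam` times the quadratic form of `S` at `B a`, which is that of
  -- `Ψ_PCA` at `a`.
  have hclt := tendstoInDistribution_scatter (m := m) (t := t) hindep hlaw hBsymm hpsd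
    (fun b => memLp_two_inner_mul_inner_mixture b t m)
    (fun a => by
      rw [integral_inner_mul_inner_mixture hα₀.le hα₁.le hSp, ← hcov, ← inner_toEuclideanLin, hAt,
        inner_smul_right, hBa, mul_zero])
    (fun a => by
      rw [integral_sq_inner_mul_inner_mixture hα₀.le hα₁.le hSp (hBh a)
        (by rw [← inner_toEuclideanLin, hSt, inner_smul_right, hBa, mul_zero]), ← hcov,
        ← inner_toEuclideanLin, ← inner_toEuclideanLin, ← inner_toEuclideanLin, hAt,
        inner_smul_right, real_inner_self_eq_norm_sq, ht, hΨ, map_smul, LinearMap.smul_apply,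
        inner_smul_right, toEuclideanLin_mul_apply, toEuclideanLin_mul_apply, hBsymm]
      ring)
  -- moments of the coordinates
  have hL1 : ∀ j, MemLp (centredCoord m j) 2 ν := memLp_two_centredCoord_mixture m
  have hL2 : ∀ jk, MemLp (centredProd m jk) 2 ν := memLp_two_centredProd_mixture m
  have hE1 : ∀ j, ∫ x, centredCoord m j x ∂ν = 0 :=
    integral_centredCoord_mixture hα₀.le hα₁.le
  have hE2 : ∀ jk : Fin p × Fin p, ∫ x, centredProd m jk x ∂ν = covMatrix ν jk.1 jk.2 :=
    integral_centredProd_mixture hα₀.le hα₁.le hSp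
  have hm1 := measurable_centredCoord m
  have hm2 := measurable_centredProd m
  choose s hs1 hs2 hs3 using fun n => exists_sign (hu n) t
  have hlead' : ∀ n : ℕ, n ≠ 0 → ∀ᵐ ω ∂P,
      ‖s n ω • u n ω - t‖ ≤ K * (Real.sqrt (sqErr ν (centredProd m) (fun i => X i ω) n)
        + sqErr ν (centredCoord m) (fun i => X i ω) n) ∧
      ‖s n ω • u n ω - t + Matrix.toEuclideanLin B
          (Matrix.toEuclideanLin (scatter m (fun i => X i ω) n) t)‖
        ≤ K * (sqErr ν (centredProd m) (fun i => X i ω) n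
          + sqErr ν (centredCoord m) (fun i => X i ω) n) := by
    intro n hn
    filter_upwards [hlead n (Nat.one_le_iff_ne_zero.2 hn), hs3 n] with ω h1 h2
    rw [sqErr_centredProd hE2, sqErr_centredCoord hE1 _ hn]
    refine hK m _ n _ hn ?_ h2
    rcases hs2 n ω with h | h
    · rw [h, neg_one_smul]
      exact h1.neg
    · rwa [h, one_smul]
  refine ⟨s, hs1, hs2, ?_, lam, ⟨Module.End.mem_eigenspace_iff.2 hAt, ht0⟩, hpsd, ?_⟩
  · have h1 := ae_tendsto_sqErr hindep hlaw hm1 fun j => (hL1 j).integrable (by norm_num)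
    have h2 := ae_tendsto_sqErr hindep hlaw hm2 fun j => (hL2 j).integrable (by norm_num)
    have h3 : ∀ᵐ ω ∂P, ∀ n : ℕ, n ≠ 0 → ‖s n ω • u n ω - t‖
        ≤ K * (Real.sqrt (sqErr ν (centredProd m) (fun i => X i ω) n)
          + sqErr ν (centredCoord m) (fun i => X i ω) n) := by
      refine ae_all_iff.2 fun n => ?_
      by_cases hn : n = 0
      · exact .of_forall fun ω h => absurd hn h
      · filter_upwards [hlead' n hn] with ω h _ using h.1
    filter_upwards [h1, h2, h3] with ω h1 h2 h3
    rw [tendsto_iff_norm_sub_tendsto_zero]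
    refine squeeze_zero' (.of_forall fun n => norm_nonneg _)
      ((eventually_ne_atTop 0).mono fun n hn => h3 n hn) ?_
    simpa using (h2.sqrt.add h1).const_mul K
  · have hmeas : ∀ n : ℕ, AEMeasurable (fun ω => Real.sqrt n • (s n ω • u n ω - t)) P := fun n =>
      (((hs1 n).aemeasurable.smul (hu n)).sub_const t).const_smul (Real.sqrt n)
    obtain ⟨c1, hc1⟩ := exists_integral_sqErr_eq_div hindep hlaw hm1 hL1
    obtain ⟨c2, hc2⟩ := exists_integral_sqErr_eq_div hindep hlaw hm2 hL2
    have hI1 := integrable_sqErr hlaw hm1 hL1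
    have hI2 := integrable_sqErr hlaw hm2 hL2
    -- Slutsky: the difference from the linear term is `√n` times the remainder of the expansion,
    -- and it vanishes in probability.
    refine tendstoInDistribution_of_tendstoInMeasure_sub _ _ hclt ?_ hmeas
    refine tendstoInMeasure_zero_of_norm_le_sqrt_mul (K := K) (c := c2 + c1)
      (R := fun n ω => sqErr ν (centredProd m) (fun i => X i ω) n
        + sqErr ν (centredCoord m) (fun i => X i ω) n)
      (fun n => (hmeas n).sub (hclt.forall_aemeasurable n)) (fun n => (hI2 n).add (hI1 n))
      (fun n ω => add_nonneg (sqErr_nonneg _ _ _ _) (sqErr_nonneg _ _ _ _)) (fun n hn => ?_)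
      fun n hn => ?_
    · rw [integral_add (hI2 n) (hI1 n), hc1 n hn, hc2 n hn, add_div]
    · filter_upwards [hlead' n hn] with ω h
      rw [Pi.sub_apply, Pi.sub_apply, sub_neg_eq_add, ← smul_add, norm_smul, Real.norm_of_nonneg
        (Real.sqrt_nonneg _)]
      exact mul_le_mul_of_nonneg_left h.2 (Real.sqrt_nonneg _)
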